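/- Let $T$ be a simplicial tree with vertex set $V(T)$, identified with its geometric realisation (edges of length $1$, path metric $d$), and let $v_0$ be a fixed vertex. Let $P$ be the set of paths without backtracking in $T$ that start at $v_0$; for a vertex $w$ let $[v_0,w]\in P$ be the path from $v_0$ to $w$. For each $i\ge 0$ fix a well-ordering $<_i$ of the set of paths in $P$ of length $i$, such that $p<_i q$ whenever the initial subpaths $p',q'$ of $p,q$ of some length $j<i$ satisfy $p'<_j q'$. For $p,q\in P$ write $p<q$ if $|p|<|q|$, or $|p|=|q|$ and $p<_{|p|}q$. For $g\in\mathrm{Aut}(T)$ let $|g|=d(v_0,gv_0)$, and let $H(g)$ be the initial subpath of $[v_0,gv_0]$ of length $\lfloor |g|/2\rfloor$. For unordered pairs $A,B$ of elements of $P$ (multisets, as the two members may coincide) write $A\prec B$ if the $<$-least element of the symmetric difference of $A$ and $B$ exists and belongs to $A$. Write $g<^\star h$ if $|g|<|h|$, or $|g|=|h|$ and $\{H(g),H(g^{-1})\}\prec\{H(h),H(h^{-1})\}$. Let $X\subseteq\mathrm{Aut}(T)$ be finite, let $G=\langle X\rangle$ and $X^{\pm}=X\cup X^{-1}$. Suppose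 that $X$ is strongly N-reduced, that is: $X$ is a free basis of $G$; $X\cap X^{-1}=\varnothing$; and $x<^\star xy$ for all $x,y\in X^\pm$ with $x\ne y^{-1}$. For $g\in X$ let $l(g)=\min_{p\in T}d(p,gp)$ (over all points $p$ of the realisation), let $\gamma(g)=\{p\in T: d(p,gp)=l(g)\}$ be its axis, and let $U^0_g=(u_g^-,u_g^+]$ be the half-open interval of $\gamma(g)$ of radius $l(g)/2$ centred at the point of $\gamma(g)$ nearest to $v_0$, its end points being named so that $[v_0,u_g^+]<[v_0,u_g^-]$ (if the end points are midpoints of edges, the corresponding paths are first extended to the outer end vertices of those edges). Let $\Gamma(G)$ be the subgraph of $T$ induced on the set of vertices $w$ such that, for every $g\in X$, the point of $\gamma(g)$ nearest to $w$ lies in $U^0_g$. Then the vertex set of $\Gamma(G)$ is $$\{\,w\in V(T) : [v_0,w]<[v_0,gw]\ \text{ for all } g\in G\setminus\{1\}\,\}.$$ In particular $\Gamma(G)$ is a fundamental domain of $G$: it is a subtree of $T$, and it contains exactly one vertex from each $G$-orbit of vertices. -/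

import Mathlib

namespace TreeAut

noncomputable section

variable {V : Type*} {T : SimpleGraph V}

/-! ### The geometric realisation of a tree -/

/-- A point of the geometric realisation of the graph `T` (seen as a 1-dimensional simplicial
complex), in barycentric coordinates: nonnegative weights on the vertices with total weight `1`,
supported on a single vertex or on the two ends of an edge. (A tree has no triangles, so a clique
of `T` has at most two elements.) -/
@[ext] structure Point (T : SimpleGraph V) where
  coord : V →₀ ℝ
  nonneg : ∀ v, 0 ≤ coord v
  sum_eq_one : ∑ v ∈ coord.support, coord v = 1
  clique : T.IsClique (coord.support : Set V)

/-- The point of the realisation given by a vertex. -/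
def Point.vertex (T : SimpleGraph V) (v : V) : Point T where
  coord := Finsupp.single v 1
  nonneg := fun w => by
    classical
    rw [Finsupp.single_apply]; split_ifs <;> norm_num
  sum_eq_one := by
    rw [Finsupp.support_single v one_ne_zero]; simp
  clique := by
    rw [Finsupp.support_single v one_ne_zero]; simp

theorem Point.support_nonempty (p : Point T) : p.coord.support.Nonempty := by
  by_contra h
  rw [Finset.not_nonempty_iff_eq_empty] at h
  have := p.sum_eq_one
  rw [h] at this
  simp at this

/-- The action of an automorphism of `T` on the realisation, affine on each edge. -/
def Point.move (g : T ≃g T) (p : Point T) : Point T where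
  coord := Finsupp.equivMapDomain g.toEquiv p.coord
  nonneg := fun v => p.nonneg _
  sum_eq_one := by
    rw [← p.sum_eq_one]
    change ∑ v ∈ p.coord.support.map g.toEquiv.toEmbedding, _ = _
    rw [Finset.sum_map]
    exact Finset.sum_congr rfl fun v _ => by
      rw [Finsupp.equivMapDomain_apply]
      exact congrArg p.coord (g.toEquiv.symm_apply_apply v)
  clique := by
    intro a ha b hb hab
    rw [Finset.mem_coe, Finsupp.mem_support_iff, Finsupp.equivMapDomain_apply] at ha hb
    have h := p.clique (Finset.mem_coe.2 (Finsupp.mem_support_iff.2 ha))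
      (Finset.mem_coe.2 (Finsupp.mem_support_iff.2 hb))
      (fun h => hab (g.toEquiv.symm.injective h))
    have h2 := g.map_adj_iff.2 h
    rwa [show g (g.toEquiv.symm a) = a from g.toEquiv.apply_symm_apply a,
      show g (g.toEquiv.symm b) = b from g.toEquiv.apply_symm_apply b] at h2

open Classical in
/-- The path metric on the realisation, all edges having length `1`. If `p` and `q` lie on a common
edge, it is the length of the segment between them on that edge. Otherwise the shortest route
leaves `p` through a vertex `a` of its carrier, follows a shortest walk to a vertex `b` of the
carrier of `q`, and then goes on to `q`; the distance from `p` to `a` is `1 - p.coord a`. -/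
def Point.dist (p q : Point T) : ℝ :=
  if T.IsClique ((p.coord.support ∪ q.coord.support : Finset V) : Set V) then
    (∑ v ∈ p.coord.support ∪ q.coord.support, |p.coord v - q.coord v|) / 2
  else
    (p.coord.support ×ˢ q.coord.support).inf'
      (p.support_nonempty.product q.support_nonempty)
      (fun x => (1 - p.coord x.1) + (T.dist x.1 x.2 : ℝ) + (1 - q.coord x.2))

/-- The translation length `l(g)`. -/
def translationLength (g : T ≃g T) : ℝ := ⨅ p : Point T, p.dist (p.move g)

/-- The minimum translation set of `g`; for hyperbolic `g` this is the axis `γ(g)`. -/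
def minSet (g : T ≃g T) : Set (Point T) := {p | p.dist (p.move g) = translationLength g}

/-- `c` is the projection of `p` onto `C`: the point of `C` nearest to `p`. -/
def IsProj (C : Set (Point T)) (p c : Point T) : Prop :=
  c ∈ C ∧ ∀ q ∈ C, p.dist c ≤ p.dist q

/-! ### Paths from the base vertex and their well-orderings -/

/-- The paths (without backtracking) in `T` with initial vertex `o`. -/
def RootedPath (T : SimpleGraph V) (o : V) := Σ w : V, T.Path o w

/-- The number of edges of a path. -/
def RootedPath.length {o : V} (p : RootedPath T o) : ℕ := (p.2 : T.Walk o p.1).length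

/-- The initial subpath with `n` edges (for `n` at most the length of `p`). -/
def RootedPath.initial {o : V} (p : RootedPath T o) (n : ℕ) : RootedPath T o :=
  ⟨(p.2 : T.Walk o p.1).getVert n, (p.2 : T.Walk o p.1).take n, p.2.2.take n⟩

/-- The path `[o, w]` in the tree `T`. -/
def geodesic (hT : T.IsTree) (o w : V) : RootedPath T o :=
  ⟨w, (hT.existsUnique_path o w).choose, (hT.existsUnique_path o w).choose_spec.1⟩

/-- A choice of well-orderings `<_i` of the sets of paths of length `i` starting at `o`, such that
`p <_i q` as soon as the initial subpaths of `p`, `q` of some length `j < i` satisfy `<_j`.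
Only the values of `level i` on paths of length `i` matter. -/
structure PathOrder (T : SimpleGraph V) (o : V) where
  level : ℕ → RootedPath T o → RootedPath T o → Prop
  isWellOrder : ∀ i, IsWellOrder {p : RootedPath T o // p.length = i}
    (fun p q => level i p.1 q.1)
  lex : ∀ (i j : ℕ) (p q : RootedPath T o), p.length = i → q.length = i → j < i →
    level j (p.initial j) (q.initial j) → level i p q

/-- The ordering of all paths starting at `o`: first by length, then by `<_i`. -/
def PathOrder.lt {o : V} (ω : PathOrder T o) (p q : RootedPath T o) : Prop :=
  p.length < q.length ∨ (p.length = q.length ∧ ω.level p.length p q)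

open Classical in
/-- The ordering `A ≺ B` of unordered pairs of paths: the least element of the symmetric
difference of `A` and `B` belongs to `A`. Pairs are multisets, since the two paths of a pair may
coincide. -/
def PathOrder.pairLT {o : V} (ω : PathOrder T o) (A B : Multiset (RootedPath T o)) : Prop :=
  ∃ p ∈ A - B, ∀ q ∈ (A - B) + (B - A), q = p ∨ ω.lt p q

/-! ### The order on automorphisms and strongly N-reduced sets -/

/-- `|g| = d(o, g o)`. -/
def len (o : V) (g : T ≃g T) : ℕ := T.dist o (g o)

/-- The initial half `H(g)`: the initial subpath of `[o, g o]` of length `⌊|g| / 2⌋`. -/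
def initialHalf (hT : T.IsTree) (o : V) (g : T ≃g T) : RootedPath T o :=
  (geodesic hT o (g o)).initial (len o g / 2)

/-- The strict order `g <⋆ h` on automorphisms: either `|g| < |h|`, or `|g| = |h|` and
`{H(g), H(g⁻¹)} ≺ {H(h), H(h⁻¹)}`. -/
def starLT (hT : T.IsTree) {o : V} (ω : PathOrder T o) (g h : T ≃g T) : Prop :=
  len o g < len o h ∨
    (len o g = len o h ∧
      ω.pairLT {initialHalf hT o g, initialHalf hT o g⁻¹}
        {initialHalf hT o h, initialHalf hT o h⁻¹})

/-- `X` is a free basis of the subgroup `G`. -/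
def IsFreeBasis (X : Set (T ≃g T)) (G : Subgroup (T ≃g T)) : Prop :=
  ∃ b : FreeGroupBasis X G, ∀ x : X, ((b x : G) : T ≃g T) = x

/-- `X^± = X ∪ X⁻¹`. -/
def symmSet (X : Set (T ≃g T)) : Set (T ≃g T) := {g | g ∈ X ∨ g⁻¹ ∈ X}

/-- `X` is strongly N-reduced: it is a free basis of the group that it generates, no element of `X`
has its inverse in `X`, and `x <⋆ x y` for all `x, y ∈ X^±` with `x ≠ y⁻¹`. -/
structure IsStronglyNReduced (hT : T.IsTree) {o : V} (ω : PathOrder T o)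
    (X : Set (T ≃g T)) : Prop where
  isFreeBasis : IsFreeBasis X (Subgroup.closure X)
  disjoint_inv : ∀ x ∈ X, x⁻¹ ∉ X
  lt_mul : ∀ x ∈ symmSet X, ∀ y ∈ symmSet X, x ≠ y⁻¹ → starLT hT ω x (x * y)

/-! ### The subtree `Γ(G)` -/

/-- The vertex at which the shortest path containing the segment from `o` to `p` ends: the vertex
of the carrier of `p` that is farthest from `o`. -/
def outerVertex (o : V) (p : Point T) : V :=
  (p.coord.support.exists_max_image (T.dist o) p.support_nonempty).choose

/-- The comparison `[o, p] < [o, q]` for points `p`, `q` of the realisation: first by length, then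
by the order of the shortest paths of `T` that contain the two segments. On vertices this is
the order of the paths themselves. -/
def segmentLT (hT : T.IsTree) {o : V} (ω : PathOrder T o) (p q : Point T) : Prop :=
  (Point.vertex T o).dist p < (Point.vertex T o).dist q ∨
    ((Point.vertex T o).dist p = (Point.vertex T o).dist q ∧
      ω.lt (geodesic hT o (outerVertex o p)) (geodesic hT o (outerVertex o q)))

/-- The half-open interval `U⁰_g = (u⁻_g, u⁺_g]` of the axis of `g` with radius `l(g) / 2`, centred
at the projection `c` of `o`: of its two end points, the one that is contained in it is the end
point `u` for which `[o, u]` is smaller. -/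
def centralInterval (hT : T.IsTree) {o : V} (ω : PathOrder T o) (g : T ≃g T) :
    Set (Point T) :=
  {p | p ∈ minSet g ∧ ∃ c, IsProj (minSet g) (Point.vertex T o) c ∧
    (c.dist p < translationLength g / 2 ∨
      (c.dist p = translationLength g / 2 ∧
        ∀ q ∈ minSet g, c.dist q = translationLength g / 2 → q ≠ p → segmentLT hT ω p q))}

/-- `Γ(G)`, for `G` generated by `X`: the subgraph of `T` induced on the vertices whose projection
to the axis of each `g ∈ X` lies in `U⁰_g`. -/
def fundamentalSubtree (hT : T.IsTree) {o : V} (ω : PathOrder T o) (X : Set (T ≃g T)) : T.Subgraph :=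
  (⊤ : T.Subgraph).induce
    {w | ∀ g ∈ X, ∃ p, IsProj (minSet g) (Point.vertex T w) p ∧ p ∈ centralInterval hT ω g}

/-- A fundamental domain of `G`: a subtree of `T` containing exactly one vertex of every orbit. -/
def IsFundamentalDomain (G : Subgroup (T ≃g T)) (S : T.Subgraph) : Prop :=
  S.coe.IsTree ∧ ∀ u : V, ∃! w : V, w ∈ S.verts ∧ ∃ g ∈ G, g u = w

end

end TreeAut

namespace TreeAut

/-! ### Distances between the vertices of a tree -/

section TreeMetric

variable {V : Type*} {T : SimpleGraph V}

/-! Identify a path from `o` with its end vertex, so that `<` orders the vertices. For `x` in `X^±`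
let `D x` be the set of vertices `w` with `x⁻¹ w < w`.

Strong N-reducedness makes the sets `D x` pairwise disjoint (`IsStronglyNReduced.disjoint`). The
length part of `<⋆` leaves only one possible overlap, a tie in which the midpoint of `[o, x o]` lies
on `[o, y o]`; the comparison of initial halves rules it out.

The rest is ping-pong. No letter fixes a vertex, so `x` maps the complement of `D x⁻¹` into `D x`. A
vertex outside every `D x` (an element of `localMinima`) is therefore sent by any nonempty reduced
word with first letter `x` into `D x`, and stops being a local minimum. The least vertex of an orbit
is a local minimum; hence each orbit has exactly one, it is the least vertex, and only `1` fixes it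
(`localMinima_eq`). Ancestors of local minima are again local minima, so these vertices span a
subtree containing `o`.

It remains to identify local minima with the vertices of `Γ(G)`, one generator `g` at a time. By
`IsTranslation.vertexLT_and_vertexLT_iff`, `w` precedes both `g w` and `g⁻¹ w` exactly when the
projection of `w` to the axis lies in `U⁰_g`: the path from `o` to `w` runs along the axis between
the two projections, so both comparisons can be read off on the axis. This is proved on vertices and
then transferred to the realisation. -/

theorem dist_symm (T : SimpleGraph V) (x y : V) : T.dist x y = T.dist y x :=
  SimpleGraph.dist_comm

theorem dist_add_dist_of_mem_support {x y m : V} (p : T.Walk x y)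
    (hp : p.length = T.dist x y) (hm : m ∈ p.support) :
    T.dist x m + T.dist m y = T.dist x y := by
  classical
  have h1 := SimpleGraph.dist_le (p.takeUntil m hm)
  have h2 := SimpleGraph.dist_le (p.dropUntil m hm)
  have h3 : (p.takeUntil m hm).length + (p.dropUntil m hm).length = p.length := by
    rw [← SimpleGraph.Walk.length_append, p.take_spec hm]
  have h4 := (p.takeUntil m hm).reachable.dist_triangle_left y
  omega

/-- Geodesic triangles in a tree are thin. -/
theorem between_or_between (hT : T.IsTree) {x y m : V}
    (h : T.dist x m + T.dist m y = T.dist x y) (z : V) :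
    T.dist x m + T.dist m z = T.dist x z ∨ T.dist z m + T.dist m y = T.dist z y := by
  classical
  obtain ⟨p₁, hp₁⟩ := hT.connected.exists_walk_length_eq_dist x m
  obtain ⟨p₂, hp₂⟩ := hT.connected.exists_walk_length_eq_dist m y
  obtain ⟨q₁, hq₁⟩ := hT.connected.exists_walk_length_eq_dist x z
  obtain ⟨q₂, hq₂⟩ := hT.connected.exists_walk_length_eq_dist z y
  have hp : (p₁.append p₂).IsPath := SimpleGraph.Walk.isPath_of_length_eq_dist _ (by
    rw [SimpleGraph.Walk.length_append]; omega)
  -- By uniqueness of paths, the path through `m` is the bypass of the detour via `z`, so its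
  -- vertices all lie on that detour.
  have he := (hT.existsUnique_path x y).unique hp (q₁.append q₂).bypass_isPath
  have hm : m ∈ (q₁.append q₂).support := by
    apply SimpleGraph.Walk.support_bypass_subset_support
    rw [← he]
    simp
  rw [SimpleGraph.Walk.mem_support_append_iff] at hm
  exact hm.imp (dist_add_dist_of_mem_support q₁ hq₁) (dist_add_dist_of_mem_support q₂ hq₂)

/-- The vertex at a given distance along a geodesic. -/
theorem exists_between (hT : T.IsTree) (x y : V) {k : ℕ} (hk : k ≤ T.dist x y) :
    ∃ m, T.dist x m = k ∧ T.dist m y = T.dist x y - k := by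
  obtain ⟨p, hp⟩ := hT.connected.exists_walk_length_eq_dist x y
  refine ⟨p.getVert k, ?_⟩
  have h1 := SimpleGraph.dist_le (p.take k)
  have h2 := SimpleGraph.dist_le (p.drop k)
  have h3 := dist_add_dist_of_mem_support p hp (p.getVert_mem_support k)
  rw [SimpleGraph.Walk.take_length] at h1
  rw [SimpleGraph.Walk.drop_length] at h2
  omega

/-- The median is the last common vertex `m` of `[x, y]` and `[x, z]`. Its successor `n` towards `y`
is off `[x, z]`, hence on `[z, y]` by thinness; as adjacent vertices never have equal distance to
`z`, this puts `m` on `[y, z]`. -/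
theorem exists_median (hT : T.IsTree) (x y z : V) :
    ∃ m, T.dist x m + T.dist m y = T.dist x y ∧ T.dist x m + T.dist m z = T.dist x z ∧
      T.dist y m + T.dist m z = T.dist y z := by
  classical
  set P : ℕ → Prop := fun k => ∃ m, T.dist x m = k ∧ T.dist x m + T.dist m y = T.dist x y ∧
    T.dist x m + T.dist m z = T.dist x z with hP
  have h0 : P 0 := ⟨x, by simp⟩
  obtain ⟨m, hm, hmy, hmz⟩ : P (Nat.findGreatest P (T.dist x y)) :=
    Nat.findGreatest_spec (Nat.zero_le _) h0
  refine ⟨m, hmy, hmz, ?_⟩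
  rcases Nat.eq_zero_or_pos (T.dist m y) with h | h
  · have := hT.connected.dist_eq_zero_iff.1 h
    subst this; simp
  obtain ⟨n, hn, hny⟩ := exists_between hT m y h
  have hadj : T.Adj m n := SimpleGraph.dist_eq_one_iff_adj.1 hn
  have ht := hT.connected.dist_triangle (u := x) (v := m) (w := n)
  have ht' := hT.connected.dist_triangle (u := x) (v := n) (w := y)
  have hxn : T.dist x n + T.dist n y = T.dist x y := by omega
  have hz := hT.dist_eq_dist_add_one_of_adj z hadj
  have hnz : T.dist x n + T.dist n z ≠ T.dist x z := by
    intro hc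
    have := Nat.le_findGreatest (P := P) (m := T.dist x n) (n := T.dist x y) (by omega)
      ⟨n, rfl, hxn, hc⟩
    omega
  have := (between_or_between hT hxn z).resolve_left hnz
  have hty := hT.connected.dist_triangle (u := z) (v := m) (w := y)
  have htz := hT.connected.dist_triangle (u := x) (v := n) (w := z)
  have c1 := dist_symm T z m
  have c2 := dist_symm T z n
  have c3 := dist_symm T y m
  have c4 := dist_symm T y z
  omega

/-- The four point condition. -/
theorem four_point (hT : T.IsTree) (x y z t : V) :
    T.dist x y + T.dist z t ≤ T.dist x z + T.dist y t ∨
      T.dist x y + T.dist z t ≤ T.dist x t + T.dist y z := by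
  -- Seen from the median, `t` branches off along at most one leg of the tripod.
  obtain ⟨m, h1, h2, h3⟩ := exists_median hT x y z
  have a1 := between_or_between hT h1 t
  have a2 := between_or_between hT h2 t
  have a3 := between_or_between hT h3 t
  have b1 := hT.connected.dist_triangle (u := x) (v := m) (w := t)
  have b2 := hT.connected.dist_triangle (u := y) (v := m) (w := t)
  have b3 := hT.connected.dist_triangle (u := z) (v := m) (w := t)
  have c1 := dist_symm T x m
  have c2 := dist_symm T y m
  have c3 := dist_symm T z m
  have c4 := dist_symm T t m
  have c5 := dist_symm T t x
  have c6 := dist_symm T t y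
  have c7 := dist_symm T t z
  omega

theorem even_perimeter (hT : T.IsTree) (x y z : V) :
    Even (T.dist x y + T.dist y z + T.dist x z) := by
  obtain ⟨m, h1, h2, h3⟩ := exists_median hT x y z
  refine ⟨T.dist x m + T.dist y m + T.dist z m, ?_⟩
  have c2 := dist_symm T y m
  have c3 := dist_symm T z m
  omega

theorem eq_of_dist_eq_zero (hT : T.IsTree) {x y : V} (h : T.dist x y = 0) : x = y :=
  hT.connected.dist_eq_zero_iff.1 h

theorem eq_of_between (hT : T.IsTree) {x y m n : V}
    (hm : T.dist x m + T.dist m y = T.dist x y) (hn : T.dist x n + T.dist n y = T.dist x y)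
    (h : T.dist x m = T.dist x n) : m = n := by
  apply eq_of_dist_eq_zero hT
  have := four_point hT x y m n
  have c1 := dist_symm T y m
  have c2 := dist_symm T y n
  omega

/-- A point of `[o, a]` that is not beyond the branching point of `[o, a]` and `[o, b]` lies on
`[o, b]`. -/
theorem between_of_le (hT : T.IsTree) {o a b m : V} (hm : T.dist o m + T.dist m a = T.dist o a)
    (h : 2 * T.dist o m + T.dist a b ≤ T.dist o a + T.dist o b) :
    T.dist o m + T.dist m b = T.dist o b := by
  have := four_point hT o a b m
  have := hT.connected.dist_triangle (u := o) (v := m) (w := b)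
  have := dist_symm T m a
  have := dist_symm T m b
  omega

theorem dist_map (g : T ≃g T) (x y : V) : T.dist (g x) (g y) = T.dist x y := by
  have key : ∀ (g : T ≃g T) (x y : V), T.dist (g x) (g y) ≤ T.dist x y := by
    intro g x y
    by_cases h : T.Reachable x y
    · obtain ⟨p, hp⟩ := h.exists_walk_length_eq_dist
      rw [← hp, ← SimpleGraph.Walk.length_map g.toHom p]
      exact SimpleGraph.dist_le (p.map g.toHom)
    · have : ¬ T.Reachable (g x) (g y) := fun h' => h (g.reachable_iff.1 h')
      rw [SimpleGraph.dist_eq_zero_of_not_reachable this]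
      exact Nat.zero_le _
  apply le_antisymm (key g x y)
  simpa using key g⁻¹ (g x) (g y)

theorem dist_map_left (g : T ≃g T) (x y : V) : T.dist (g x) y = T.dist x (g⁻¹ y) := by
  rw [← dist_map g x (g⁻¹ y), RelIso.apply_inv_self]

end TreeMetric

/-! ### The order on vertices induced by the order on paths -/

section VertexOrder

variable {V : Type*} {T : SimpleGraph V} (hT : T.IsTree) {o : V} (ω : PathOrder T o)

theorem RootedPath.eq_geodesic (p : RootedPath T o) : p = geodesic hT o p.1 := by
  obtain ⟨w, p⟩ := p
  have := (hT.existsUnique_path o w).unique p.2 (hT.existsUnique_path o w).choose_spec.1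
  unfold geodesic
  congr 1
  exact Subtype.ext this

theorem length_geodesic (w : V) : (geodesic hT o w).length = T.dist o w := by
  obtain ⟨p, hp, hl⟩ := hT.connected.exists_path_of_dist o w
  rw [← hl, ← (RootedPath.eq_geodesic hT ⟨w, p, hp⟩ : _ = geodesic hT o w)]
  rfl

theorem geodesic_injective : Function.Injective (geodesic hT o) := fun _ _ h =>
  congrArg Sigma.fst h

theorem initial_geodesic {m w : V} (h : T.dist o m + T.dist m w = T.dist o w) :
    (geodesic hT o w).initial (T.dist o m) = geodesic hT o m := by
  rw [RootedPath.eq_geodesic hT (RootedPath.initial _ _)]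
  congr 1
  have hl := length_geodesic hT (o := o) w
  obtain ⟨p, hp⟩ : ∃ p : T.Path o w, geodesic hT o w = ⟨w, p⟩ := ⟨_, rfl⟩
  rw [hp] at hl ⊢
  have hl' : (p : T.Walk o w).length = T.dist o w := hl
  change (p : T.Walk o w).getVert (T.dist o m) = m
  have h1 := dist_add_dist_of_mem_support (p : T.Walk o w) hl'
    (SimpleGraph.Walk.getVert_mem_support _ (T.dist o m))
  refine eq_of_between hT h1 h ?_
  have h2 := SimpleGraph.dist_le ((p : T.Walk o w).take (T.dist o m))
  have h3 := SimpleGraph.dist_le ((p : T.Walk o w).drop (T.dist o m))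
  rw [SimpleGraph.Walk.take_length] at h2
  rw [SimpleGraph.Walk.drop_length] at h3
  omega

/-- The order of the vertices given by the order of the paths from `o`. -/
def vertexLT (u v : V) : Prop := ω.lt (geodesic hT o u) (geodesic hT o v)

variable {hT ω}

theorem vertexLT_iff {u v : V} : vertexLT hT ω u v ↔ T.dist o u < T.dist o v ∨
    (T.dist o u = T.dist o v ∧ ω.level (T.dist o u) (geodesic hT o u) (geodesic hT o v)) := by
  unfold vertexLT PathOrder.lt
  rw [length_geodesic, length_geodesic]

theorem vertexLT.irrefl (u : V) : ¬ vertexLT hT ω u u := by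
  rw [vertexLT_iff]
  rintro (h | ⟨-, h⟩)
  · exact lt_irrefl _ h
  · have := ω.isWellOrder (T.dist o u)
    exact irrefl_of (fun p q : {p : RootedPath T o // p.length = T.dist o u} =>
      ω.level (T.dist o u) p.1 q.1) ⟨_, length_geodesic hT u⟩ h

theorem vertexLT.trans {u v w : V} (h₁ : vertexLT hT ω u v) (h₂ : vertexLT hT ω v w) :
    vertexLT hT ω u w := by
  rw [vertexLT_iff] at *
  rcases h₁ with h₁ | ⟨e₁, h₁⟩ <;> rcases h₂ with h₂ | ⟨e₂, h₂⟩
  · left; omega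
  · left; omega
  · left; omega
  · right
    refine ⟨by omega, ?_⟩
    have := ω.isWellOrder (T.dist o u)
    rw [← e₁] at h₂
    exact trans_of (fun p q : {p : RootedPath T o // p.length = T.dist o u} =>
      ω.level (T.dist o u) p.1 q.1) (a := ⟨_, length_geodesic hT u⟩)
      (b := ⟨_, (length_geodesic hT v).trans e₁.symm⟩)
      (c := ⟨_, (length_geodesic hT w).trans (e₁.trans e₂).symm⟩) h₁ h₂

theorem vertexLT.asymm {u v : V} (h : vertexLT hT ω u v) : ¬ vertexLT hT ω v u :=
  fun h' => vertexLT.irrefl u (h.trans h')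

theorem vertexLT.trichotomous (u v : V) : vertexLT hT ω u v ∨ u = v ∨ vertexLT hT ω v u := by
  rw [vertexLT_iff, vertexLT_iff]
  rcases lt_trichotomy (T.dist o u) (T.dist o v) with h | h | h
  · exact Or.inl (Or.inl h)
  · have := ω.isWellOrder (T.dist o u)
    rcases trichotomous_of (fun p q : {p : RootedPath T o // p.length = T.dist o u} =>
      ω.level (T.dist o u) p.1 q.1) ⟨_, length_geodesic hT u⟩
      ⟨_, (length_geodesic hT v).trans h.symm⟩ with h' | h' | h'
    · exact Or.inl (Or.inr ⟨h, h'⟩)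
    · exact Or.inr (Or.inl (geodesic_injective hT (congrArg Subtype.val h')))
    · change ω.level _ (geodesic hT o v) (geodesic hT o u) at h'
      rw [h] at h'
      exact Or.inr (Or.inr (Or.inr ⟨h.symm, h'⟩))
  · exact Or.inr (Or.inr (Or.inl h))

theorem vertexLT.dist_le {u v : V} (h : vertexLT hT ω u v) : T.dist o u ≤ T.dist o v := by
  rw [vertexLT_iff] at h
  omega

/-- The order of vertices is decided by the order of ancestors. -/
theorem vertexLT.of_ancestors {u v u' v' : V} (h : vertexLT hT ω u' v')
    (hu : T.dist o u' + T.dist u' u = T.dist o u) (hv : T.dist o v' + T.dist v' v = T.dist o v)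
    (he : T.dist o u = T.dist o v) (he' : T.dist o u' = T.dist o v') : vertexLT hT ω u v := by
  -- `lex` compares strictly shorter initial subpaths only, so `u' = u` is separate.
  rcases Nat.eq_zero_or_pos (T.dist u' u) with h0 | h0
  · have e1 := eq_of_dist_eq_zero hT h0
    have e2 := eq_of_dist_eq_zero hT (show T.dist v' v = 0 by omega)
    rwa [← e1, ← e2]
  · rw [vertexLT_iff] at *
    rcases h with h | ⟨-, h⟩
    · omega
    · refine Or.inr ⟨he, ω.lex _ (T.dist o u') _ _ (length_geodesic hT u)
        ((length_geodesic hT v).trans he.symm) (by omega) ?_⟩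
      rwa [initial_geodesic hT hu, he', initial_geodesic hT hv, ← he']

theorem exists_vertexLT_minimal (S : Set V) (hS : S.Nonempty) :
    ∃ v ∈ S, ∀ w ∈ S, w = v ∨ vertexLT hT ω v w := by
  classical
  obtain ⟨u, hu, hmin⟩ := (measure (fun v => T.dist o v)).wf.has_min S hS
  change ∀ x ∈ S, ¬ T.dist o x < T.dist o u at hmin
  have := ω.isWellOrder (T.dist o u)
  have hwf : WellFounded (fun p q : {p : RootedPath T o // p.length = T.dist o u} =>
      ω.level (T.dist o u) p.1 q.1) := IsWellFounded.wf
  obtain ⟨⟨p, hp⟩, hpS, hpm⟩ := hwf.has_min {p | p.1.1 ∈ S}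
    ⟨⟨geodesic hT o u, length_geodesic hT u⟩, hu⟩
  refine ⟨p.1, hpS, fun w hw => ?_⟩
  rcases vertexLT.trichotomous (hT := hT) (ω := ω) w p.1 with h | h | h
  · exfalso
    have hd : T.dist o p.1 = T.dist o u := by
      rw [← hp, ← length_geodesic hT p.1, ← RootedPath.eq_geodesic hT p]
    rw [vertexLT_iff, ← RootedPath.eq_geodesic hT p] at h
    rcases h with h | ⟨h, h'⟩
    · exact hmin w hw (by omega)
    · refine hpm ⟨geodesic hT o w, (length_geodesic hT w).trans (by omega)⟩ hw ?_
      rwa [h, hd] at h'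
  · exact Or.inl h
  · exact Or.inr h

end VertexOrder

/-! ### Strong N-reducedness and the disjointness of the sets `D x` -/

section NReduced

variable {V : Type*} {T : SimpleGraph V} {hT : T.IsTree} {o : V} {ω : PathOrder T o}

theorem initialHalf_eq {g : T ≃g T} {m : V} (h : T.dist o m = T.dist o (g o) / 2)
    (hm : T.dist o m + T.dist m (g o) = T.dist o (g o)) :
    initialHalf hT o g = geodesic hT o m := by
  unfold initialHalf len
  rw [← h, initial_geodesic hT hm]

theorem dist_inv_apply_self (g : T ≃g T) (o : V) : T.dist o (g⁻¹ o) = T.dist o (g o) := by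
  rw [dist_symm T o (g o), dist_map_left]

theorem not_pairLT_self (A : Multiset (RootedPath T o)) : ¬ ω.pairLT A A := by
  rintro ⟨p, hp, -⟩
  simp at hp

open Classical in
theorem pair_sub_pair {p a b : RootedPath T o} (h : a ≠ b) :
    ({p, a} : Multiset (RootedPath T o)) - {p, b} = {a} := by
  rw [Multiset.insert_eq_cons, Multiset.insert_eq_cons, Multiset.sub_cons,
    Multiset.erase_cons_head, Multiset.sub_singleton, Multiset.erase_of_notMem]
  simpa using h.symm

/-- Once the common member cancels, the symmetric difference is `{u, v}`, and its least element `v`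
belongs to the second pair. -/
theorem not_pairLT_of_vertexLT {p : RootedPath T o} {u v : V} (h : vertexLT hT ω v u) :
    ¬ ω.pairLT {p, geodesic hT o u} {p, geodesic hT o v} := by
  have hne : geodesic hT o u ≠ geodesic hT o v := by
    intro he
    rw [geodesic_injective hT he] at h
    exact vertexLT.irrefl _ h
  rintro ⟨q, hq, hmin⟩
  rw [pair_sub_pair hne, Multiset.mem_singleton] at hq
  rw [pair_sub_pair hne, pair_sub_pair hne.symm] at hmin
  rcases hmin (geodesic hT o v) (by simp) with hv | hv
  · exact hne (hq.symm.trans hv.symm)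
  · rw [hq] at hv
    exact vertexLT.asymm h hv

variable {X : Set (T ≃g T)}

theorem inv_mem_symmSet {x : T ≃g T} (hx : x ∈ symmSet X) : x⁻¹ ∈ symmSet X := by
  rcases hx with hx | hx
  · exact Or.inr (by rwa [inv_inv])
  · exact Or.inl hx

theorem IsStronglyNReduced.ne_inv (hX : IsStronglyNReduced hT ω X) {x : T ≃g T}
    (hx : x ∈ symmSet X) : x ≠ x⁻¹ := by
  intro h
  have h' : x ∈ X := by
    rcases hx with hx | hx
    · exact hx
    · rwa [h]
  exact hX.disjoint_inv x h' (h ▸ h')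

/-- This is the length part of `x⁻¹ <⋆ x⁻¹ y`, as `|x⁻¹ y| = d(x o, y o)`. -/
theorem IsStronglyNReduced.len_le (hX : IsStronglyNReduced hT ω X) {x y : T ≃g T}
    (hx : x ∈ symmSet X) (hy : y ∈ symmSet X) (hxy : x ≠ y) :
    T.dist o (x o) ≤ T.dist (x o) (y o) := by
  have := hX.lt_mul x⁻¹ (inv_mem_symmSet hx) y hy (fun h => hxy (inv_injective h))
  have h2 := dist_map_left x o (y o)
  have h3 := dist_inv_apply_self x o
  unfold starLT len at this
  change T.dist o (x⁻¹ o) < T.dist o (x⁻¹ (y o)) ∨ T.dist o (x⁻¹ o) = T.dist o (x⁻¹ (y o)) ∧ _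
    at this
  omega

theorem IsStronglyNReduced.pairLT (hX : IsStronglyNReduced hT ω X) {x y : T ≃g T}
    (hx : x ∈ symmSet X) (hy : y ∈ symmSet X) (hxy : x ≠ y)
    (h : T.dist o (x o) = T.dist (x o) (y o)) :
    ω.pairLT {initialHalf hT o x⁻¹, initialHalf hT o x}
        {initialHalf hT o (x⁻¹ * y), initialHalf hT o (y⁻¹ * x)} := by
  have := hX.lt_mul x⁻¹ (inv_mem_symmSet hx) y hy (fun h => hxy (inv_injective h))
  have h2 := dist_map_left x o (y o)
  have h3 := dist_inv_apply_self x o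
  rcases this with h' | ⟨-, h'⟩
  · exfalso
    change T.dist o (x⁻¹ o) < T.dist o (x⁻¹ (y o)) at h'
    omega
  · rwa [inv_inv, mul_inv_rev, inv_inv] at h'

/-- The elements of a strongly N-reduced set are hyperbolic. -/
theorem IsStronglyNReduced.hyperbolic (hX : IsStronglyNReduced hT ω X) {x : T ≃g T}
    (hx : x ∈ symmSet X) : T.dist o (x o) < T.dist o (x (x o)) := by
  have hi := dist_inv_apply_self x o
  have hd := dist_map_left x⁻¹ o (x o)
  rw [inv_inv] at hd
  have hx' := inv_mem_symmSet hx
  have hle := hX.len_le hx' hx (hX.ne_inv hx).symm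
  by_contra hlt
  have heq : T.dist o (x⁻¹ o) = T.dist (x⁻¹ o) (x o) := by omega
  have hp := hX.pairLT hx' hx (hX.ne_inv hx).symm heq
  rw [inv_inv] at hp
  obtain ⟨r, hr⟩ := even_perimeter hT o (x⁻¹ o) (x o)
  -- The triangle `o, x⁻¹ o, x o` is now equilateral, so `m` is the midpoint of every side. Since
  -- `x` carries the side `[x⁻¹ o, o]` to `[o, x o]`, it fixes `m`; then `x`, `x⁻¹`, `x²` and `x⁻²`
  -- all have initial half `[o, m]`, and no strict comparison is possible.
  obtain ⟨m, h1, h2, h3⟩ := exists_median hT o (x⁻¹ o) (x o)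
  have c1 := dist_symm T m (x⁻¹ o)
  have hm : T.dist o m = T.dist o (x o) / 2 := by omega
  have hxm : x m = m := by
    have e1 := dist_map_left x m o
    have e2 := dist_map x m o
    have c2 := dist_symm T m o
    have c3 := dist_symm T (x m) o
    refine eq_of_between hT (x := o) (y := x o) ?_ h2 ?_ <;> omega
  have hxm' : x⁻¹ m = m := by
    conv_lhs => rw [← hxm]
    exact RelIso.inv_apply_self x m
  have e1 := dist_map x m (x o)
  have e2 := dist_map x⁻¹ m (x⁻¹ o)
  have e3 := dist_inv_apply_self (x * x) o
  rw [mul_inv_rev, RelIso.mul_apply, RelIso.mul_apply] at e3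
  rw [hxm] at e1
  rw [hxm'] at e2
  rw [initialHalf_eq (m := m) (g := x) hm h2, initialHalf_eq (m := m) (g := x⁻¹) (by omega) h1,
    initialHalf_eq (m := m) (g := x * x), initialHalf_eq (m := m) (g := x⁻¹ * x⁻¹)] at hp
  · exact not_pairLT_self _ hp
  all_goals rw [RelIso.mul_apply]; omega

theorem IsStronglyNReduced.apply_ne (hX : IsStronglyNReduced hT ω X) {x : T ≃g T}
    (hx : x ∈ symmSet X) (w : V) : x w ≠ w := by
  intro h
  have h1 := hX.hyperbolic hx
  have h2 := four_point hT o (x (x o)) (x o) w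
  have h3 := dist_map x o w
  have h4 := dist_map x (x o) w
  have h5 := dist_map x o (x o)
  have h6 := dist_symm T (x (x o)) (x o)
  rw [h] at h3 h4
  omega

/-- In Gromov products at `o`, `hle` says `(x o | w) ≤ (y o | w)`. Then `(x o | y o) ≥ (x o | w) ≥
|x| / 2` by `dx`, while `len_le` gives `(x o | y o) ≤ |x| / 2`; equality must hold throughout. -/
theorem IsStronglyNReduced.tie_of_le (hX : IsStronglyNReduced hT ω X) {x y : T ≃g T}
    (hx : x ∈ symmSet X) (hy : y ∈ symmSet X) (hxy : x ≠ y) {w : V}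
    (hle : T.dist o (x o) + T.dist (y o) w ≤ T.dist o (y o) + T.dist (x o) w)
    (dx : T.dist (x o) w ≤ T.dist o w) (dy : T.dist (y o) w ≤ T.dist o w) :
    T.dist (x o) w = T.dist o w ∧ T.dist o (y o) = T.dist (x o) (y o) ∧
      T.dist o (x o) ≤ T.dist o (y o) := by
  have lx := hX.len_le hx hy hxy
  have ly := hX.len_le hy hx hxy.symm
  have c1 := dist_symm T (x o) (y o)
  have c2 := dist_symm T (x o) w
  have c3 := dist_symm T (y o) w
  have c4 := dist_symm T o w
  have q1 := four_point hT o w (x o) (y o)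
  refine ⟨?_, ?_, ?_⟩ <;> omega

/-- The tie gives `|y⁻¹ x| = |y|`, so initial halves decide `y⁻¹ <⋆ y⁻¹ x`. The elements `y⁻¹` and
`y⁻¹ x` share their half, leaving `H(y)` against `H(x⁻¹ y)`. As `|x| ≤ |y|`, these extend `[o, m]`
and `[o, x⁻¹ m]`, so `x⁻¹ m < m` would reverse the required order. -/
theorem IsStronglyNReduced.not_vertexLT_midpoint (hX : IsStronglyNReduced hT ω X) {x y : T ≃g T}
    (hx : x ∈ symmSet X) (hy : y ∈ symmSet X) (hxy : x ≠ y) {m : V}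
    (leny : T.dist o (y o) = T.dist (x o) (y o)) (lexy : T.dist o (x o) ≤ T.dist o (y o))
    (hm1 : 2 * T.dist o m = T.dist o (x o)) (hm2 : T.dist (x o) m = T.dist o m)
    (hmy : T.dist o m + T.dist m (y o) = T.dist o (y o)) : ¬ vertexLT hT ω (x⁻¹ m) m := by
  intro hlt
  have c1 := dist_symm T (x o) (y o)
  have hp := hX.pairLT hy hx hxy.symm (by omega)
  have d2 := dist_map x⁻¹ m (y o)
  have d3 := dist_map_left x o m
  have d5 := dist_map_left x o (y o)
  have e1 := dist_inv_apply_self y o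
  have e2 := dist_map_left y o (x o)
  have e3 := dist_map y⁻¹ o (x o)
  obtain ⟨h₁, h11, h12⟩ := exists_between hT o (y⁻¹ o) (k := T.dist o (y o) / 2) (by omega)
  obtain ⟨h₂, h21, h22⟩ := exists_between hT o (y o) (k := T.dist o (y o) / 2) (by omega)
  obtain ⟨h₃, h31, h32⟩ := exists_between hT o (x⁻¹ (y o)) (k := T.dist o (y o) / 2) (by omega)
  rw [initialHalf_eq (m := h₁) (g := y⁻¹) (by omega) (by omega),
    initialHalf_eq (m := h₂) (g := y) (by omega) (by omega),
    initialHalf_eq (m := h₁) (g := y⁻¹ * x), initialHalf_eq (m := h₃) (g := x⁻¹ * y)] at hp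
  · refine not_pairLT_of_vertexLT (hlt.of_ancestors ?_ ?_ ?_ ?_) hp
    · refine between_of_le hT (a := x⁻¹ (y o)) (by omega) ?_
      have := dist_symm T (x⁻¹ (y o)) h₃
      omega
    · refine between_of_le hT hmy ?_
      have := dist_symm T (y o) h₂
      omega
    · omega
    · omega
  · rw [RelIso.mul_apply]; omega
  · rw [RelIso.mul_apply]; omega
  · rw [RelIso.mul_apply]; omega
  · rw [RelIso.mul_apply]
    exact between_of_le hT (a := y⁻¹ o) (by omega) (by omega)

/-- The half-trees of the vertices that are moved down by the inverses of the elements of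
`X^±` are disjoint. -/
theorem IsStronglyNReduced.disjoint_of_le (hX : IsStronglyNReduced hT ω X) {x y : T ≃g T}
    (hx : x ∈ symmSet X) (hy : y ∈ symmSet X) (hxy : x ≠ y) {w : V}
    (hle : T.dist o (x o) + T.dist (y o) w ≤ T.dist o (y o) + T.dist (x o) w)
    (hwx : vertexLT hT ω (x⁻¹ w) w) (hwy : vertexLT hT ω (y⁻¹ w) w) : False := by
  have dx := hwx.dist_le
  have dy := hwy.dist_le
  rw [← dist_map_left] at dx dy
  obtain ⟨tie, leny, lexy⟩ := hX.tie_of_le hx hy hxy hle dx dy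
  -- Two sides of this triangle are equal, so `|x|` is even and the midpoint of `[o, x o]` is a
  -- vertex.
  obtain ⟨r, hr⟩ := even_perimeter hT o (x o) (y o)
  obtain ⟨m, hm1, hm2⟩ := exists_between hT o (x o) (k := T.dist o (x o) / 2) (by omega)
  have c5 := dist_symm T m (x o)
  have hm : T.dist o m + T.dist m (x o) = T.dist o (x o) := by omega
  have hmw : T.dist o m + T.dist m w = T.dist o w := between_of_le hT hm (by omega)
  have hmy : T.dist o m + T.dist m (y o) = T.dist o (y o) := between_of_le hT hm (by omega)
  refine hX.not_vertexLT_midpoint hx hy hxy leny lexy (by omega) (by omega) hmy ?_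
  have d1 := dist_map x⁻¹ m w
  have d3 := dist_map_left x o m
  have d4 := dist_map_left x o w
  -- The vertices `w` and `x⁻¹ w` are equally far from `o` and lie beyond `m` and `x⁻¹ m`, so they
  -- inherit the order of the latter.
  rcases vertexLT.trichotomous (hT := hT) (ω := ω) (x⁻¹ m) m with h | h | h
  · exact h
  · exact absurd h (hX.apply_ne (inv_mem_symmSet hx) m)
  · refine absurd hwx (vertexLT.asymm (h.of_ancestors hmw ?_ ?_ ?_)) <;> omega

theorem IsStronglyNReduced.disjoint (hX : IsStronglyNReduced hT ω X) {x y : T ≃g T}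
    (hx : x ∈ symmSet X) (hy : y ∈ symmSet X) (hxy : x ≠ y) {w : V}
    (hwx : vertexLT hT ω (x⁻¹ w) w) : ¬ vertexLT hT ω (y⁻¹ w) w := fun hwy =>
  (le_total (T.dist o (x o) + T.dist (y o) w) (T.dist o (y o) + T.dist (x o) w)).elim
    (fun h => hX.disjoint_of_le hx hy hxy h hwx hwy)
    (fun h => hX.disjoint_of_le hy hx hxy.symm h hwy hwx)

/-! ### Ping-pong and the least vertices of orbits -/

/-- The vertices that no element of `X^±` moves down. -/
def localMinima (hT : T.IsTree) (ω : PathOrder T o) (X : Set (T ≃g T)) : Set V :=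
  {w | ∀ x ∈ symmSet X, vertexLT hT ω w (x w)}

theorem exists_reduced_word {g : T ≃g T} (hg : g ∈ Subgroup.closure X) :
    ∃ l : List (T ≃g T), (∀ x ∈ l, x ∈ symmSet X) ∧ l.IsChain (fun x y => x ≠ y⁻¹) ∧
      l.prod = g := by
  have cons : ∀ y ∈ symmSet X, ∀ g : T ≃g T,
      (∃ l : List (T ≃g T), (∀ x ∈ l, x ∈ symmSet X) ∧ l.IsChain (fun x y => x ≠ y⁻¹) ∧
      l.prod = g) → ∃ l : List (T ≃g T), (∀ x ∈ l, x ∈ symmSet X) ∧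
      l.IsChain (fun x y => x ≠ y⁻¹) ∧ l.prod = y * g := by
    rintro y hy g ⟨l, hl, hc, rfl⟩
    match l with
    | [] => exact ⟨[y], by simpa using hy, by simp, by simp⟩
    | x :: l =>
      by_cases h : y = x⁻¹
      · exact ⟨l, fun z hz => hl z (List.mem_cons_of_mem _ hz), hc.tail, by simp [h]⟩
      · exact ⟨y :: x :: l, by simpa using ⟨hy, by simpa using hl⟩,
          List.isChain_cons_cons.2 ⟨h, hc⟩, by simp⟩
  induction hg using Subgroup.closure_induction_left with
  | one => exact ⟨[], by simp, by simp, by simp⟩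
  | mul_left y hy g hg ih => exact cons y (Or.inl hy) g ih
  | inv_mul_cancel y hy g hg ih => exact cons y⁻¹ (Or.inr (by rwa [inv_inv])) g ih

theorem IsStronglyNReduced.not_vertexLT_inv (hX : IsStronglyNReduced hT ω X) {x : T ≃g T}
    (hx : x ∈ symmSet X) {w : V} (hw : ¬ vertexLT hT ω (x w) w) : vertexLT hT ω w (x w) := by
  rcases vertexLT.trichotomous (hT := hT) (ω := ω) (x w) w with h | h | h
  · exact absurd h hw
  · exact absurd h (hX.apply_ne hx w)
  · exact h

/-- Inductively the tail of the word sends `w` into `D y`; as `y ≠ x⁻¹`, that set misses `D x⁻¹`,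
and `x` maps the complement of `D x⁻¹` into `D x`. -/
theorem IsStronglyNReduced.ping_pong (hX : IsStronglyNReduced hT ω X) {w : V}
    (hw : w ∈ localMinima hT ω X) : ∀ (l : List (T ≃g T)) (x : T ≃g T),
      (∀ y ∈ x :: l, y ∈ symmSet X) → (x :: l).IsChain (fun x y => x ≠ y⁻¹) →
      vertexLT hT ω (x⁻¹ ((x :: l).prod w)) ((x :: l).prod w)
  | [], x, hl, _ => by
    simpa using hw x (hl x (by simp))
  | y :: l, x, hl, hc => by
    have hx := hl x (by simp)
    have hy := hl y (by simp)
    have ih := ping_pong hX hw l y (fun z hz => hl z (List.mem_cons_of_mem _ hz)) hc.tail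
    rw [List.isChain_cons_cons] at hc
    rw [List.prod_cons, RelIso.mul_apply, RelIso.inv_apply_self]
    apply hX.not_vertexLT_inv hx
    have := hX.disjoint hy (inv_mem_symmSet hx) (fun h => hc.1 (by rw [h, inv_inv])) ih
    rwa [inv_inv] at this

theorem IsStronglyNReduced.exists_moved_down (hX : IsStronglyNReduced hT ω X) {g : T ≃g T}
    (hg : g ∈ Subgroup.closure X) (h1 : g ≠ 1) {w : V} (hw : w ∈ localMinima hT ω X) :
    ∃ x ∈ symmSet X, vertexLT hT ω (x (g w)) (g w) := by
  obtain ⟨l, hl, hc, rfl⟩ := exists_reduced_word hg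
  match l with
  | [] => exact absurd rfl h1
  | x :: l => exact ⟨x⁻¹, inv_mem_symmSet (hl x (by simp)), hX.ping_pong hw l x hl hc⟩

theorem symmSet_subset_closure : symmSet X ⊆ Subgroup.closure X := by
  rintro x (hx | hx)
  · exact Subgroup.subset_closure hx
  · exact (Subgroup.inv_mem_iff _).1 (Subgroup.subset_closure hx)

theorem IsStronglyNReduced.eq_of_mem_localMinima (hX : IsStronglyNReduced hT ω X) {g : T ≃g T}
    (hg : g ∈ Subgroup.closure X) {w : V} (hw : w ∈ localMinima hT ω X)
    (hgw : g w ∈ localMinima hT ω X) : g = 1 := by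
  by_contra h
  obtain ⟨x, hx, h⟩ := hX.exists_moved_down hg h hw
  exact h.asymm (hgw x hx)

theorem IsStronglyNReduced.exists_mem_localMinima (hX : IsStronglyNReduced hT ω X) (u : V) :
    ∃ g ∈ Subgroup.closure X, g u ∈ localMinima hT ω X ∧
      ∀ h ∈ Subgroup.closure X, h u = g u ∨ vertexLT hT ω (g u) (h u) := by
  obtain ⟨v, ⟨g, hg, rfl⟩, hmin⟩ := exists_vertexLT_minimal (hT := hT) (ω := ω)
    {v | ∃ g ∈ Subgroup.closure X, g u = v} ⟨u, 1, one_mem _, rfl⟩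
  refine ⟨g, hg, fun x hx => ?_, fun h hh => hmin _ ⟨h, hh, rfl⟩⟩
  exact (hmin (x (g u)) ⟨x * g, mul_mem (symmSet_subset_closure hx) hg, rfl⟩).resolve_left
    (hX.apply_ne hx _)

theorem IsStronglyNReduced.localMinima_eq (hX : IsStronglyNReduced hT ω X) :
    localMinima hT ω X = {w : V | ∀ g ∈ Subgroup.closure X, g ≠ 1 →
      ω.lt (geodesic hT o w) (geodesic hT o (g w))} := by
  ext w
  constructor
  · intro hw g hg h1
    obtain ⟨h, hh, hhw, hmin⟩ := hX.exists_mem_localMinima w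
    obtain rfl := hX.eq_of_mem_localMinima hh hw hhw
    rcases hmin g hg with h' | h'
    · refine absurd (hX.eq_of_mem_localMinima hg hw ?_) h1
      rwa [h']
    · exact h'
  · intro hw x hx
    refine hw x (symmSet_subset_closure hx) ?_
    rintro rfl
    exact hX.apply_ne hx w rfl

/-- If `h u < u`, then `h w` is no farther from `o` than `w`; with `w < h w` the lengths agree and
`h u` is an ancestor of `h w`, so `h w < w`. Local minima are thus closed under passing to
ancestors. -/
theorem vertexLT.of_descendants {h : T ≃g T} {u w : V} (hu : T.dist o u + T.dist u w = T.dist o w)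
    (hne : h u ≠ u) (hw : vertexLT hT ω w (h w)) : vertexLT hT ω u (h u) := by
  rcases vertexLT.trichotomous (hT := hT) (ω := ω) u (h u) with h' | h' | h'
  · exact h'
  · exact absurd h'.symm hne
  · exfalso
    have h1 := h'.dist_le
    have h2 := hw.dist_le
    have h3 := dist_map h u w
    have h4 := hT.connected.dist_triangle (u := o) (v := h u) (w := h w)
    exact hw.asymm (h'.of_ancestors (by omega) hu (by omega) (by omega))

theorem IsStronglyNReduced.isFundamentalDomain (hX : IsStronglyNReduced hT ω X)
    {S : T.Subgraph} (hS : S = (⊤ : T.Subgraph).induce (localMinima hT ω X)) :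
    IsFundamentalDomain (Subgroup.closure X) S := by
  have hv : S.verts = localMinima hT ω X := by rw [hS]; rfl
  refine ⟨⟨?_, hT.isAcyclic.subgraph S⟩, fun u => ?_⟩
  · have ho : o ∈ S.verts := by
      rw [hv]
      intro x hx
      rw [vertexLT_iff, SimpleGraph.dist_self]
      exact Or.inl (hT.connected.pos_dist_of_ne (hX.apply_ne hx o).symm)
    have key : ∀ (n : ℕ) (w : S.verts), T.dist o w = n → S.coe.Reachable w ⟨o, ho⟩ := by
      intro n
      induction n with
      | zero =>
        rintro ⟨w, hw⟩ h
        have : w = o := (eq_of_dist_eq_zero hT h).symm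
        subst this
        rfl
      | succ n ih =>
        rintro ⟨w, hw⟩ h
        change T.dist o w = n + 1 at h
        obtain ⟨u, hu1, hu2⟩ := exists_between hT o w (k := n) (by omega)
        have hu : u ∈ S.verts := by
          rw [hv] at hw ⊢
          exact fun x hx => (hw x hx).of_descendants (by omega) (hX.apply_ne hx u)
        have hadj : S.coe.Adj ⟨w, hw⟩ ⟨u, hu⟩ := by
          rw [SimpleGraph.Subgraph.coe_adj]
          have : T.Adj u w := SimpleGraph.dist_eq_one_iff_adj.1 (by omega)
          subst hS
          exact ⟨hw, hu, this.symm⟩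
        exact hadj.reachable.trans (ih ⟨u, hu⟩ hu1)
    have : Nonempty S.verts := ⟨⟨o, ho⟩⟩
    exact ⟨fun v w => (key _ v rfl).trans (key _ w rfl).symm⟩
  · rw [hv]
    obtain ⟨g, hg, hgu, -⟩ := hX.exists_mem_localMinima u
    refine ⟨g u, ⟨hgu, g, hg, rfl⟩, ?_⟩
    rintro w ⟨hw, h, hh, rfl⟩
    have := hX.eq_of_mem_localMinima (mul_mem hh (inv_mem hg)) hgu (by
      rwa [RelIso.mul_apply, RelIso.inv_apply_self])
    rw [mul_inv_eq_one.1 this]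

end NReduced

/-! ### Hyperbolic automorphisms and projections to their axes -/

section Axis

variable {V : Type*} {T : SimpleGraph V}

/-- `g` is hyperbolic with translation length `l` on the vertices. -/
structure IsTranslation (g : T ≃g T) (l : ℕ) : Prop where
  pos : 0 < l
  le (v : V) : l ≤ T.dist v (g v)
  -- This excludes inversions of edges, which satisfy the other conditions with `l = 1`.
  two_mul_le (v : V) : 2 * l ≤ T.dist v (g (g v))
  exists_eq : ∃ v, T.dist v (g v) = l

/-- The vertices of the axis of `g`, when `g` has translation length `l`. -/
def axisVertices (g : T ≃g T) (l : ℕ) : Set V := {v | T.dist v (g v) = l}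

/-- Read as a lower bound for the displacement of every `v` in terms of the single vertex `o`. -/
theorem dist_sq_le (hT : T.IsTree) (g : T ≃g T) (o v : V) :
    T.dist o (g (g o)) ≤ T.dist o (g o) + T.dist v (g v) := by
  have h1 := four_point hT o (g (g o)) (g o) (g v)
  have h2 := dist_map g (g o) v
  have h3 := dist_map g o v
  have h4 := dist_map g o (g o)
  have h5 := dist_symm T (g (g o)) (g o)
  have h6 := hT.connected.dist_triangle (u := g o) (v := g v) (w := v)
  have h7 := hT.connected.dist_triangle (u := o) (v := v) (w := g v)
  have h8 := dist_symm T v (g v)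
  omega

theorem IsTranslation.of_lt (hT : T.IsTree) {g : T ≃g T} {o : V}
    (h : T.dist o (g o) < T.dist o (g (g o))) :
    IsTranslation g (T.dist o (g (g o)) - T.dist o (g o)) := by
  have hle := dist_sq_le hT g o
  obtain ⟨r, hr⟩ := even_perimeter hT o (g o) (g (g o))
  have h1 := dist_map g o (g o)
  have htri := hT.connected.dist_triangle (u := o) (v := g o) (w := g (g o))
  -- With `l = |g²| - |g|` this distance is `(|g| - l) / 2`: `a` is the point where `[o, g o]`
  -- reaches the axis. The parity of the perimeter makes `|g²|` even.
  obtain ⟨a, ha1, ha2⟩ := exists_between hT o (g o)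
    (k := T.dist o (g o) - T.dist o (g (g o)) / 2) (by omega)
  have h2 := dist_map g o a
  have h3 := dist_map g a (g o)
  have h4 := dist_symm T (g o) o
  have h5 := dist_symm T (g (g o)) o
  have h6 : T.dist (g o) (g a) + T.dist (g a) o = T.dist (g o) o :=
    between_of_le hT (a := g (g o)) (by omega) (by omega)
  have haxis : T.dist a (g a) = T.dist o (g (g o)) - T.dist o (g o) := by
    have := hle a
    have := four_point hT o (g o) a (g a)
    have := dist_symm T (g a) o
    have := dist_symm T (g o) a
    omega
  have h7 := dist_map g (g o) (g a)
  have h8 := dist_symm T (g (g a)) (g (g o))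
  have h9 : 2 * T.dist a (g a) ≤ T.dist a (g (g a)) := by
    have := hT.connected.dist_triangle (u := o) (v := a) (w := g (g o))
    have := hT.connected.dist_triangle (u := a) (v := g (g a)) (w := g (g o))
    omega
  replace hle : ∀ v, T.dist a (g a) ≤ T.dist v (g v) := fun v => by have := hle v; omega
  rw [← haxis]
  have pos : 0 < T.dist a (g a) := by omega
  clear h1 h2 h3 h4 h5 h6 h7 h8 haxis htri ha1 ha2 hr
  refine ⟨pos, hle, fun v => ?_, a, rfl⟩
  -- The orbit of `a` runs along a line, so `d(a, g⁴ a) = 4 l` and `d(a, g² a) = 2 l`; the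
  -- displacement bound for `g²` gives the claim.
  have k1 := dist_sq_le hT (g * g) a v
  simp only [RelIso.mul_apply] at k1
  have k2 := four_point hT a (g (g a)) (g a) (g (g (g a)))
  have k3 := four_point hT a (g (g (g a))) (g a) (g (g (g (g a))))
  simp only [dist_map] at k2 k3
  have k4 := dist_symm T (g (g a)) (g a)
  have k5 := dist_symm T (g (g (g a))) (g a)
  simp only [dist_map] at k4 k5
  have k6 := hT.connected.dist_triangle (u := a) (v := g a) (w := g (g a))
  rw [dist_map] at k6
  omega

variable {g : T ≃g T} {l : ℕ}

theorem mem_axisVertices {v : V} : v ∈ axisVertices g l ↔ T.dist v (g v) = l := Iff.rfl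

theorem IsTranslation.inv (h : IsTranslation g l) : IsTranslation g⁻¹ l where
  pos := h.pos
  le v := by
    rw [dist_inv_apply_self]
    exact h.le v
  two_mul_le v := by
    have := dist_inv_apply_self (g * g) v
    rw [mul_inv_rev, RelIso.mul_apply, RelIso.mul_apply] at this
    rw [this]
    exact h.two_mul_le v
  exists_eq := by
    obtain ⟨v, hv⟩ := h.exists_eq
    exact ⟨v, by rwa [dist_inv_apply_self]⟩

theorem axisVertices_inv : axisVertices g⁻¹ l = axisVertices g l := by
  ext v
  rw [mem_axisVertices, mem_axisVertices, dist_inv_apply_self]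

theorem apply_mem_axisVertices {v : V} (hv : v ∈ axisVertices g l) : g v ∈ axisVertices g l := by
  rw [mem_axisVertices] at *
  rwa [dist_map]

theorem inv_apply_mem_axisVertices {v : V} (hv : v ∈ axisVertices g l) :
    g⁻¹ v ∈ axisVertices g l := by
  rw [← axisVertices_inv] at *
  exact apply_mem_axisVertices hv

theorem IsTranslation.apply_ne (h : IsTranslation g l) (v : V) : g v ≠ v := by
  intro hv
  have h1 := h.le v
  have h2 := h.pos
  rw [hv, SimpleGraph.dist_self] at h1
  omega

theorem dist_inv_apply_of_dist_apply (hT : T.IsTree) {c p : V}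
    (hc : c ∈ axisVertices g l) (hp : p ∈ axisVertices g l)
    (hd : T.dist c (g p) = T.dist c p + l) :
    l ≤ T.dist c p ∧ T.dist c (g⁻¹ p) + l = T.dist c p ∨
      T.dist c p ≤ l ∧ T.dist c (g⁻¹ p) + T.dist c p = l := by
  rw [mem_axisVertices] at hc hp
  have h1 := four_point hT c (g p) (g c) p
  have h2 := four_point hT c p (g c) (g p)
  have h3 := dist_map g c p
  have h4 := dist_map_left g c p
  have h5 := dist_symm T (g p) p
  have h6 := dist_symm T (g p) (g c)
  have h7 := dist_symm T p (g c)
  have h8 := hT.connected.dist_triangle (u := c) (v := g c) (w := p)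
  have h9 := hT.connected.dist_triangle (u := g c) (v := p) (w := g p)
  have h10 := hT.connected.dist_triangle (u := c) (v := p) (w := g c)
  have h11 := dist_symm T c (g c)
  omega

/-- One of `g`, `g⁻¹` moves the point `p` of the axis towards `c`, the other one away from `c`. -/
theorem IsTranslation.exists_towards (hT : T.IsTree) (h : IsTranslation g l) {c p : V}
    (hc : c ∈ axisVertices g l) (hp : p ∈ axisVertices g l) :
    ∃ k : T ≃g T, (k = g ∨ k = g⁻¹) ∧ T.dist c (k⁻¹ p) = T.dist c p + l ∧
      (l ≤ T.dist c p ∧ T.dist c (k p) + l = T.dist c p ∨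
        T.dist c p ≤ l ∧ T.dist c (k p) + T.dist c p = l) := by
  have h1 := four_point hT (g⁻¹ p) (g p) p c
  have h2 := h.two_mul_le (g⁻¹ p)
  rw [RelIso.apply_inv_self] at h2
  have h3 := hp
  have h4 := hp
  rw [← axisVertices_inv, mem_axisVertices] at h4
  rw [mem_axisVertices] at h3
  have h5 := dist_symm T (g⁻¹ p) p
  have h6 := dist_symm T (g p) p
  have h7 := dist_symm T (g⁻¹ p) c
  have h8 := dist_symm T (g p) c
  have h9 := dist_symm T p c
  have h10 := hT.connected.dist_triangle (u := c) (v := p) (w := g p)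
  have h11 := hT.connected.dist_triangle (u := c) (v := p) (w := g⁻¹ p)
  have h12 : T.dist c (g p) = T.dist c p + l ∨ T.dist c (g⁻¹ p) = T.dist c p + l := by omega
  rcases h12 with h12 | h12
  · exact ⟨g⁻¹, Or.inr rfl, by rwa [inv_inv], dist_inv_apply_of_dist_apply hT hc hp h12⟩
  · refine ⟨g, Or.inl rfl, h12, ?_⟩
    have := dist_inv_apply_of_dist_apply hT (axisVertices_inv ▸ hc) (axisVertices_inv ▸ hp) h12
    rwa [inv_inv] at this

theorem IsTranslation.mem_of_between (hT : T.IsTree) (h : IsTranslation g l) {p q m : V}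
    (hp : p ∈ axisVertices g l) (hq : q ∈ axisVertices g l)
    (hm : T.dist p m + T.dist m q = T.dist p q) : m ∈ axisVertices g l := by
  rw [mem_axisVertices] at *
  have h1 := four_point hT m (g m) p q
  have h2 := h.le m
  have h3 := dist_map g m q
  have h4 := dist_map g m p
  have h5 := hT.connected.dist_triangle (u := g m) (v := g q) (w := q)
  have h6 := hT.connected.dist_triangle (u := g m) (v := g p) (w := p)
  have h7 := dist_symm T p m
  have h8 := dist_symm T p (g p)
  have h9 := dist_symm T q (g q)
  omega

/-- `p` is the vertex of the axis of `g` nearest to `w`. -/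
def IsAxisProj (g : T ≃g T) (l : ℕ) (w p : V) : Prop :=
  p ∈ axisVertices g l ∧ ∀ q ∈ axisVertices g l, T.dist w q = T.dist w p + T.dist p q

theorem IsTranslation.exists_isAxisProj (hT : T.IsTree) (h : IsTranslation g l) (w : V) :
    ∃ p, IsAxisProj g l w p := by
  obtain ⟨p, hp, hmin⟩ := (measure (fun v => T.dist w v)).wf.has_min (axisVertices g l)
    h.exists_eq
  change ∀ x ∈ axisVertices g l, ¬ T.dist w x < T.dist w p at hmin
  refine ⟨p, hp, fun q hq => ?_⟩
  obtain ⟨m, h1, h2, h3⟩ := exists_median hT w p q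
  have h4 := hmin m (h.mem_of_between hT hp hq h3)
  have : m = p := eq_of_dist_eq_zero hT (by omega)
  subst this
  omega

theorem IsAxisProj.inv {w p : V} (hp : IsAxisProj g l w p) : IsAxisProj g⁻¹ l w p := by
  unfold IsAxisProj
  rwa [axisVertices_inv]

theorem IsAxisProj.map {w p : V} (hp : IsAxisProj g l w p) :
    IsAxisProj g l (g w) (g p) := by
  refine ⟨apply_mem_axisVertices hp.1, fun q hq => ?_⟩
  rw [dist_map_left, dist_map, dist_map_left g p]
  exact hp.2 _ (inv_apply_mem_axisVertices hq)

/-- When the projections differ, the path from `o` to `w` enters the axis at `c` and leaves it at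
`p`. -/
theorem IsAxisProj.dist_eq (hT : T.IsTree) {o w c p : V} (hc : IsAxisProj g l o c)
    (hp : IsAxisProj g l w p) (hne : c ≠ p) :
    T.dist o w = T.dist o c + T.dist c p + T.dist p w := by
  have h1 := hc.2 p hp.1
  have h2 := hp.2 c hc.1
  have h3 := hT.connected.pos_dist_of_ne hne
  have h4 := four_point hT o p w c
  have h5 := hT.connected.dist_triangle (u := o) (v := c) (w := w)
  have h6 := dist_symm T c p
  have h7 := dist_symm T c w
  have h8 := dist_symm T p w
  omega

/-- A vertex `r` with `r` and `g r` both at distance `l / 2` from `c` is the midpoint of `[c, g⁻¹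
c]`, hence unique. Either `q` or `g⁻¹ q` is such a vertex. -/
theorem IsTranslation.eq_or_eq_of_dist_eq (hT : T.IsTree) (h : IsTranslation g l) {c p q : V}
    (hc : c ∈ axisVertices g l) (hp : p ∈ axisVertices g l) (hq : q ∈ axisVertices g l)
    (hl : 2 * T.dist c p = l) (hpq : T.dist c q = T.dist c p)
    (hgp : T.dist c (g p) = T.dist c p) : q = p ∨ q = g p := by
  have key : ∀ {r : V}, T.dist c r = T.dist c p → T.dist c (g r) = T.dist c p → r = p := by
    intro r h1 h2
    have e1 := dist_map_left g⁻¹ c r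
    have e2 := dist_map_left g⁻¹ c p
    rw [inv_inv] at e1 e2
    have e3 := mem_axisVertices.1 (axisVertices_inv ▸ hc : c ∈ axisVertices g⁻¹ l)
    have e4 := dist_symm T (g⁻¹ c) r
    have e5 := dist_symm T (g⁻¹ c) p
    exact eq_of_between hT (x := c) (y := g⁻¹ c) (by omega) (by omega) h1
  obtain ⟨k, rfl | rfl, -, hk⟩ := h.exists_towards hT hc hq
  · exact Or.inl (key hpq (by omega))
  · right
    rw [← key (r := g⁻¹ q) (by omega) (by rwa [RelIso.apply_inv_self]), RelIso.apply_inv_self]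

variable {hT : T.IsTree} {o : V} {ω : PathOrder T o}

theorem vertexLT_of_two_mul_lt {w c p : V}
    (hc : IsAxisProj g l o c) (hp : IsAxisProj g l w p) (hlt : 2 * T.dist c p < l) :
    vertexLT hT ω w (g w) := by
  have h1 := mem_axisVertices.1 hp.1
  have h2 := hT.connected.dist_triangle (u := p) (v := c) (w := g p)
  have h3 := dist_symm T c p
  have h4 := hc.dist_eq hT hp.map (by
    intro he
    rw [← he] at h1
    omega)
  have h5 := hT.connected.dist_triangle (u := o) (v := c) (w := w)
  have h6 := hT.connected.dist_triangle (u := c) (v := p) (w := w)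
  have h7 := dist_map g p w
  rw [vertexLT_iff]
  left; omega

/-- Here `w` and `g w` are equally far from `o` and hang at equal depth below `p` and `g p`, so
order passes both ways between the pairs. -/
theorem IsTranslation.vertexLT_iff_of_two_mul_eq (h : IsTranslation g l) {w c p : V}
    (hc : IsAxisProj g l o c) (hp : IsAxisProj g l w p) (hl : 2 * T.dist c p = l)
    (hgp : T.dist c (g p) = T.dist c p) :
    vertexLT hT ω w (g w) ↔ vertexLT hT ω p (g p) := by
  have hpos := h.pos
  have h1 := hc.dist_eq hT hp (by rintro rfl; rw [SimpleGraph.dist_self] at hl; omega)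
  have h2 := hc.dist_eq hT hp.map (by intro he; rw [← he, SimpleGraph.dist_self] at hgp; omega)
  have h3 := hc.2 p hp.1
  have h4 := hc.2 _ hp.map.1
  have h5 := dist_map g p w
  constructor
  · exact fun h' => h'.of_descendants (by omega) (h.apply_ne p)
  · exact fun h' => h'.of_ancestors (by omega) (by omega) (by omega) (by omega)

/-- Let `k` be whichever of `g`, `g⁻¹` moves `p` towards `c`. If `p` is beyond radius `l / 2`, then
`k w` is nearer to `o` than `w`. At radius exactly `l / 2`, `k⁻¹ w` is farther than `w`, and `k p`
is the other end of the interval, so only `p` against `k p` matters. -/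
theorem IsTranslation.vertexLT_and_vertexLT_iff (h : IsTranslation g l) {w c p : V}
    (hc : IsAxisProj g l o c) (hp : IsAxisProj g l w p) :
    vertexLT hT ω w (g w) ∧ vertexLT hT ω w (g⁻¹ w) ↔
      2 * T.dist c p < l ∨ 2 * T.dist c p = l ∧
        ∀ q ∈ axisVertices g l, T.dist c q = T.dist c p → q ≠ p → vertexLT hT ω p q := by
  rcases lt_or_ge (2 * T.dist c p) l with hlt | hge
  · exact iff_of_true ⟨vertexLT_of_two_mul_lt hc hp hlt,
      vertexLT_of_two_mul_lt hc.inv hp.inv hlt⟩ (Or.inl hlt)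
  suffices H : ∀ k : T ≃g T, IsTranslation k l → IsAxisProj k l o c → IsAxisProj k l w p →
      T.dist c (k⁻¹ p) = T.dist c p + l →
      (l ≤ T.dist c p ∧ T.dist c (k p) + l = T.dist c p ∨
        T.dist c p ≤ l ∧ T.dist c (k p) + T.dist c p = l) →
      (vertexLT hT ω w (k w) ∧ vertexLT hT ω w (k⁻¹ w) ↔
      2 * T.dist c p < l ∨ 2 * T.dist c p = l ∧
        ∀ q ∈ axisVertices k l, T.dist c q = T.dist c p → q ≠ p → vertexLT hT ω p q) by
    obtain ⟨k, rfl | rfl, hk⟩ := h.exists_towards hT hc.1 hp.1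
    · exact H _ h hc hp hk.1 hk.2
    · have := H _ h.inv hc.inv hp.inv hk.1 hk.2
      rwa [and_comm, inv_inv, axisVertices_inv] at this
  intro k hk hc hp hk1 hk2
  have hpos := hk.pos
  have hne : c ≠ p := by rintro rfl; rw [SimpleGraph.dist_self] at hge; omega
  have h1 := hc.dist_eq hT hp hne
  have h2 := hT.connected.dist_triangle (u := o) (v := c) (w := k w)
  have h3 := hT.connected.dist_triangle (u := c) (v := k p) (w := k w)
  have h4 := dist_map k p w
  rcases hge.lt_or_eq with hgt | heq
  · refine iff_of_false ?_ (by omega)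
    rintro ⟨h', -⟩
    have := h'.dist_le
    omega
  · have hkp : T.dist c (k p) = T.dist c p := by omega
    have h5 : vertexLT hT ω w (k⁻¹ w) := by
      have h6 := hc.inv.dist_eq hT hp.inv.map (by
        intro he; rw [← he, SimpleGraph.dist_self] at hk1; omega)
      have h7 := dist_map k⁻¹ p w
      rw [vertexLT_iff]
      left; omega
    rw [hk.vertexLT_iff_of_two_mul_eq hc hp heq.symm hkp]
    constructor
    · rintro ⟨h', -⟩
      refine Or.inr ⟨heq.symm, fun q hq hcq hqp => ?_⟩
      rcases hk.eq_or_eq_of_dist_eq hT hc.1 hp.1 hq heq.symm hcq hkp with h8 | h8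
      · exact absurd h8 hqp
      · rwa [h8]
    · rintro (h' | ⟨-, h'⟩)
      · omega
      · exact ⟨h' _ (apply_mem_axisVertices hp.1) hkp (hk.apply_ne p), h5⟩

end Axis

/-! ### From the points of the realisation to vertices -/

section Realisation

variable {V : Type*} {T : SimpleGraph V}

theorem eq_or_eq_or_eq_of_isClique (hT : T.IsTree) {s : Set V} (hs : T.IsClique s) {a b c : V}
    (ha : a ∈ s) (hb : b ∈ s) (hc : c ∈ s) : a = b ∨ b = c ∨ a = c := by
  by_contra! h
  have h1 := SimpleGraph.dist_eq_one_iff_adj.2 (hs ha hb h.1)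
  have h2 := SimpleGraph.dist_eq_one_iff_adj.2 (hs ha hc h.2.2)
  exact hT.dist_ne_of_adj a (hs hb hc h.2.1) (h1.trans h2.symm)

theorem Point.eq_vertex_or_edge (hT : T.IsTree) (p : Point T) :
    (∃ a, p = Point.vertex T a) ∨ ∃ a b, T.Adj a b ∧ (∀ v, v ∈ p.coord.support ↔ v = a ∨ v = b) ∧
      0 < p.coord a ∧ 0 < p.coord b ∧ p.coord a + p.coord b = 1 := by
  classical
  obtain ⟨a, ha⟩ := p.support_nonempty
  have pos : ∀ v ∈ p.coord.support, 0 < p.coord v := fun v hv =>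
    lt_of_le_of_ne (p.nonneg v) (Finsupp.mem_support_iff.1 hv).symm
  by_cases h : ∃ b ∈ p.coord.support, b ≠ a
  · right
    obtain ⟨b, hb, hba⟩ := h
    have hs : ∀ v, v ∈ p.coord.support ↔ v = a ∨ v = b := by
      intro v
      constructor
      · intro hv
        rcases eq_or_eq_or_eq_of_isClique hT p.clique ha hb hv with h | h | h
        · exact absurd h.symm hba
        · exact Or.inr h.symm
        · exact Or.inl h.symm
      · rintro (rfl | rfl) <;> assumption
    refine ⟨a, b, p.clique ha hb hba.symm, hs, pos a ha, pos b hb, ?_⟩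
    have he : p.coord.support = {a, b} := by ext v; simp [hs]
    have := p.sum_eq_one
    rwa [he, Finset.sum_pair hba.symm] at this
  · left
    push Not at h
    have he : p.coord.support = {a} := by
      ext v
      rw [Finset.mem_singleton]
      exact ⟨h v, fun h => h ▸ ha⟩
    have h1 := p.sum_eq_one
    rw [he, Finset.sum_singleton] at h1
    refine ⟨a, Point.ext ?_⟩
    change p.coord = Finsupp.single a 1
    rw [← h1]
    exact Finsupp.support_subset_singleton.1 he.subset

theorem Point.support_vertex (v : V) : (Point.vertex T v).coord.support = {v} :=
  Finsupp.support_single v one_ne_zero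

theorem Point.coord_vertex_self (v : V) : (Point.vertex T v).coord v = 1 :=
  Finsupp.single_eq_same

theorem Point.coord_vertex_of_ne {v w : V} (h : w ≠ v) : (Point.vertex T v).coord w = 0 :=
  Finsupp.single_eq_of_ne h

theorem Point.vertex_injective : Function.Injective (Point.vertex T) := fun v w h => by
  have := congrArg (fun p => p.coord.support) h
  simpa [Point.support_vertex] using this

theorem Point.move_vertex (g : T ≃g T) (v : V) :
    (Point.vertex T v).move g = Point.vertex T (g v) := by
  apply Point.ext
  exact Finsupp.equivMapDomain_single g.toEquiv v 1

theorem Point.mem_support_move (g : T ≃g T) (p : Point T) (v : V) :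
    v ∈ (p.move g).coord.support ↔ g⁻¹ v ∈ p.coord.support := by
  rw [Finsupp.mem_support_iff, Finsupp.mem_support_iff]
  rfl

theorem Point.coord_move (g : T ≃g T) (p : Point T) (v : V) :
    (p.move g).coord (g v) = p.coord v :=
  congrArg p.coord (g.toEquiv.symm_apply_apply v)

theorem Point.dist_vertex_vertex (v w : V) :
    (Point.vertex T v).dist (Point.vertex T w) = T.dist v w := by
  classical
  unfold Point.dist
  rcases eq_or_ne v w with rfl | hne
  · rw [if_pos]
    · simp
    · simp [Point.support_vertex]
  split_ifs with h
  · have hadj : T.Adj v w := h (by simp [Point.support_vertex]) (by simp [Point.support_vertex]) hne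
    have hs : (Point.vertex T v).coord.support ∪ (Point.vertex T w).coord.support = {v, w} := by
      rw [Point.support_vertex, Point.support_vertex]; rfl
    rw [SimpleGraph.dist_eq_one_iff_adj.2 hadj]
    trans (∑ u ∈ {v, w}, |(Point.vertex T v).coord u - (Point.vertex T w).coord u|) / 2
    · rw [← hs]
    · rw [Finset.sum_pair hne, Point.coord_vertex_self, Point.coord_vertex_self,
        Point.coord_vertex_of_ne hne, Point.coord_vertex_of_ne hne.symm]
      norm_num
  · simp [Point.support_vertex, Point.coord_vertex_self]

theorem Point.dist_vertex_edge (hT : T.IsTree) {w a b : V} {p : Point T} (hab : T.Adj a b)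
    (hs : ∀ v, v ∈ p.coord.support ↔ v = a ∨ v = b) (h1 : p.coord a + p.coord b = 1)
    (hb : 0 < p.coord b) (ha : 0 < p.coord a)
    (hw : T.dist w b = T.dist w a + 1) :
    (Point.vertex T w).dist p = T.dist w a + p.coord b := by
  classical
  have hwb : w ≠ b := by
    rintro rfl
    rw [SimpleGraph.dist_self] at hw
    omega
  have hwb' : (T.dist w b : ℝ) = T.dist w a + 1 := by exact_mod_cast hw
  unfold Point.dist
  split_ifs with h
  · have : w = a := by
      rcases eq_or_eq_or_eq_of_isClique hT h (a := w) (b := a) (c := b)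
        (by simp [Point.support_vertex]) (Finset.mem_union_right _ ((hs a).2 (Or.inl rfl)))
        (Finset.mem_union_right _ ((hs b).2 (Or.inr rfl))) with h | h | h
      · exact h
      · exact absurd h hab.ne
      · exact absurd h hwb
    subst this
    have hs' : (Point.vertex T w).coord.support ∪ p.coord.support = {w, b} := by
      ext v
      simp only [Finset.mem_union, Point.support_vertex, hs, Finset.mem_singleton,
        Finset.mem_insert]
      tauto
    rw [SimpleGraph.dist_self, Nat.cast_zero, zero_add]
    trans (∑ u ∈ {w, b}, |(Point.vertex T w).coord u - p.coord u|) / 2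
    · rw [← hs']
    · rw [Finset.sum_pair hwb, Point.coord_vertex_self, Point.coord_vertex_of_ne hwb.symm,
        abs_of_nonneg (by linarith), zero_sub, abs_neg, abs_of_pos hb]
      linarith
  · apply le_antisymm
    · refine (Finset.inf'_le _ (b := (w, a)) ?_).trans ?_
      · simp only [Finset.mem_product, Point.support_vertex, hs]
        simp
      · simp only [Point.coord_vertex_self]
        linarith
    · rw [Finset.le_inf'_iff]
      rintro ⟨u, v⟩ huv
      simp only [Finset.mem_product, Point.support_vertex, hs, Finset.mem_singleton] at huv
      obtain ⟨rfl, rfl | rfl⟩ := huv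
      · simp only [Point.coord_vertex_self]
        linarith
      · simp only [Point.coord_vertex_self]
        linarith

/-- A point that is not a vertex lies on an edge whose first end is nearer to `w`. -/
theorem Point.exists_dist_vertex_edge (hT : T.IsTree) (w : V) {p : Point T}
    (hp : ∀ v, p ≠ Point.vertex T v) :
    ∃ a b, a ∈ p.coord.support ∧ 0 < p.coord b ∧ p.coord b < 1 ∧
      (Point.vertex T w).dist p = T.dist w a + p.coord b := by
  rcases p.eq_vertex_or_edge hT with ⟨a, rfl⟩ | ⟨a, b, hab, hs, ha, hb, h1⟩
  · exact absurd rfl (hp a)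
  · rcases hT.dist_eq_dist_add_one_of_adj w hab with h | h
    · exact ⟨b, a, (hs b).2 (Or.inr rfl), ha, by linarith,
        Point.dist_vertex_edge hT hab.symm (fun v => (hs v).trans or_comm) (by linarith) ha hb h⟩
    · exact ⟨a, b, (hs a).2 (Or.inl rfl), hb, by linarith,
        Point.dist_vertex_edge hT hab hs h1 hb ha h⟩

variable {g : T ≃g T} {l : ℕ}

theorem Point.dist_move_edge (hT : T.IsTree) (h : IsTranslation g l) {a b : V} {p : Point T}
    (hab : T.Adj a b) (hs : ∀ v, v ∈ p.coord.support ↔ v = a ∨ v = b)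
    (ha : 0 < p.coord a) (hb : 0 < p.coord b) (h1 : p.coord a + p.coord b = 1) :
    l ≤ p.dist (p.move g) ∧
      (p.dist (p.move g) = l ↔ a ∈ axisVertices g l ∧ b ∈ axisVertices g l) := by
  classical
  have hmove : ∀ v, v ∈ (p.move g).coord.support ↔ v = g a ∨ v = g b := by
    intro v
    rw [Point.mem_support_move, hs]
    constructor
    · rintro (h | h)
      · left; rw [← h, RelIso.apply_inv_self]
      · right; rw [← h, RelIso.apply_inv_self]
    · rintro (h | h)
      · left; rw [h, RelIso.inv_apply_self]
      · right; rw [h, RelIso.inv_apply_self]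
  -- A clique in a tree has at most two vertices, so otherwise `g` would invert the edge `ab`.
  have hnc : ¬ T.IsClique ((p.coord.support ∪ (p.move g).coord.support : Finset V) : Set V) := by
    intro hc
    have ma := Finset.mem_coe.2 (Finset.mem_union_left (p.move g).coord.support
      ((hs a).2 (Or.inl rfl)))
    have mb := Finset.mem_coe.2 (Finset.mem_union_left (p.move g).coord.support
      ((hs b).2 (Or.inr rfl)))
    have mga := Finset.mem_coe.2 (Finset.mem_union_right p.coord.support
      ((hmove (g a)).2 (Or.inl rfl)))
    have mgb := Finset.mem_coe.2 (Finset.mem_union_right p.coord.support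
      ((hmove (g b)).2 (Or.inr rfl)))
    have e1 : g a = b := by
      rcases eq_or_eq_or_eq_of_isClique hT hc ma mb mga with h' | h' | h'
      · exact absurd h' hab.ne
      · exact h'.symm
      · exact absurd h'.symm (h.apply_ne a)
    have e2 : g b = a := by
      rcases eq_or_eq_or_eq_of_isClique hT hc ma mb mgb with h' | h' | h'
      · exact absurd h' hab.ne
      · exact absurd h'.symm (h.apply_ne b)
      · exact h'.symm
    have := h.two_mul_le a
    have := h.pos
    rw [e1, e2, SimpleGraph.dist_self] at *
    omega
  have hab' := SimpleGraph.dist_eq_one_iff_adj.2 hab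
  have hgab : T.dist (g a) (g b) = 1 := (dist_map g a b).trans hab'
  have la := h.le a
  have lb := h.le b
  have t1 := hT.connected.dist_triangle (u := a) (v := g b) (w := g a)
  have t2 := hT.connected.dist_triangle (u := b) (v := a) (w := g b)
  have t3 := hT.connected.dist_triangle (u := b) (v := g a) (w := g b)
  have t4 := hT.connected.dist_triangle (u := a) (v := b) (w := g a)
  have c1 := dist_symm T (g b) (g a)
  have c2 := dist_symm T b a
  have la' : (l : ℝ) ≤ T.dist a (g a) := by exact_mod_cast la
  have lb' : (l : ℝ) ≤ T.dist b (g b) := by exact_mod_cast lb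
  have lab : (l : ℝ) ≤ T.dist a (g b) + 1 := by exact_mod_cast (by omega)
  have lba : (l : ℝ) ≤ T.dist b (g a) + 1 := by exact_mod_cast (by omega)
  unfold Point.dist
  rw [if_neg hnc]
  -- The routes `a → g a` and `b → g b` exceed `l` strictly. On the crossed routes the two partial
  -- edges add up to `1`, so only these can attain `l`.
  have hle : (l : ℝ) ≤ (p.coord.support ×ˢ (p.move g).coord.support).inf'
      (p.support_nonempty.product (p.move g).support_nonempty)
      (fun x => (1 - p.coord x.1) + (T.dist x.1 x.2 : ℝ) + (1 - (p.move g).coord x.2)) := by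
    rw [Finset.le_inf'_iff]
    rintro ⟨u, v⟩ huv
    rw [Finset.mem_product, hs, hmove] at huv
    obtain ⟨hu | hu, hv | hv⟩ := huv <;> simp only at hu hv <;>
      simp only [hu, hv, Point.coord_move] <;> linarith
  refine ⟨hle, ?_, ?_⟩
  · intro he
    obtain ⟨⟨u, v⟩, huv, hmin⟩ := Finset.exists_mem_eq_inf'
      (p.support_nonempty.product (p.move g).support_nonempty)
      (fun x => (1 - p.coord x.1) + (T.dist x.1 x.2 : ℝ) + (1 - (p.move g).coord x.2))
    rw [he] at hmin
    rw [Finset.mem_product, hs, hmove] at huv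
    rw [mem_axisVertices, mem_axisVertices]
    obtain ⟨hu | hu, hv | hv⟩ := huv <;> simp only at hu hv <;>
      simp only [hu, hv, Point.coord_move] at hmin
    · linarith
    · have : l = T.dist a (g b) + 1 := by
        have : (l : ℝ) = T.dist a (g b) + 1 := by linarith
        exact_mod_cast this
      omega
    · have : l = T.dist b (g a) + 1 := by
        have : (l : ℝ) = T.dist b (g a) + 1 := by linarith
        exact_mod_cast this
      omega
    · linarith
  · rintro ⟨hA, hB⟩
    rw [mem_axisVertices] at hA hB
    refine le_antisymm ?_ hle
    have q := four_point hT a (g b) b (g a)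
    have c3 := dist_symm T (g b) b
    have pos := h.pos
    have : T.dist a (g b) + 1 = l ∨ T.dist b (g a) + 1 = l := by
      have q1 := hT.dist_eq_dist_add_one_of_adj a (g.map_adj_iff.2 hab)
      have q2 := hT.dist_eq_dist_add_one_of_adj b (g.map_adj_iff.2 hab)
      omega
    rcases this with h' | h'
    · have h' : (T.dist a (g b) : ℝ) + 1 = l := by exact_mod_cast h'
      refine (Finset.inf'_le _ (b := (a, g b)) ?_).trans ?_
      · rw [Finset.mem_product, hs, hmove]; simp
      · simp only [Point.coord_move]
        linarith
    · have h' : (T.dist b (g a) : ℝ) + 1 = l := by exact_mod_cast h'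
      refine (Finset.inf'_le _ (b := (b, g a)) ?_).trans ?_
      · rw [Finset.mem_product, hs, hmove]; simp
      · simp only [Point.coord_move]
        linarith

theorem IsTranslation.dist_move (hT : T.IsTree) (h : IsTranslation g l) (p : Point T) :
    l ≤ p.dist (p.move g) ∧
      (p.dist (p.move g) = l ↔ ∀ v ∈ p.coord.support, v ∈ axisVertices g l) := by
  rcases p.eq_vertex_or_edge hT with ⟨a, rfl⟩ | ⟨a, b, hab, hs, ha, hb, h1⟩
  · rw [Point.move_vertex, Point.dist_vertex_vertex, Point.support_vertex]
    simp only [Finset.mem_singleton, forall_eq, mem_axisVertices, Nat.cast_inj, Nat.cast_le,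
      and_true, h.le a]
  · obtain ⟨h2, h3⟩ := Point.dist_move_edge hT h hab hs ha hb h1
    refine ⟨h2, h3.trans ⟨?_, fun h => ⟨h a ((hs a).2 (Or.inl rfl)), h b ((hs b).2 (Or.inr rfl))⟩⟩⟩
    rintro ⟨hA, hB⟩ v hv
    rcases (hs v).1 hv with rfl | rfl <;> assumption

theorem IsTranslation.translationLength_eq (hT : T.IsTree) (h : IsTranslation g l) :
    translationLength g = l := by
  obtain ⟨v, hv⟩ := h.exists_eq
  have : Nonempty (Point T) := ⟨Point.vertex T v⟩
  apply le_antisymm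
  · refine (ciInf_le ⟨(l : ℝ), ?_⟩ (Point.vertex T v)).trans ?_
    · rintro _ ⟨p, rfl⟩
      exact (h.dist_move hT p).1
    · rw [Point.move_vertex, Point.dist_vertex_vertex, hv]
  · exact le_ciInf fun p => (h.dist_move hT p).1

theorem IsTranslation.mem_minSet (hT : T.IsTree) (h : IsTranslation g l) (p : Point T) :
    p ∈ minSet g ↔ ∀ v ∈ p.coord.support, v ∈ axisVertices g l := by
  rw [← (h.dist_move hT p).2, ← h.translationLength_eq hT]
  rfl

theorem IsTranslation.vertex_mem_minSet (hT : T.IsTree) (h : IsTranslation g l) (v : V) :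
    Point.vertex T v ∈ minSet g ↔ v ∈ axisVertices g l := by
  rw [h.mem_minSet hT, Point.support_vertex]
  simp

/-- A non-vertex point of the axis has both ends of its edge on the axis and is strictly farther
from `w` than the nearer end, so the nearest point is a vertex. -/
theorem IsTranslation.isProj_iff (hT : T.IsTree) (h : IsTranslation g l) {w p : V}
    (hp : IsAxisProj g l w p) (q : Point T) :
    IsProj (minSet g) (Point.vertex T w) q ↔ q = Point.vertex T p := by
  have key : ∀ q ∈ minSet g, q ≠ Point.vertex T p →
      (Point.vertex T w).dist (Point.vertex T p) < (Point.vertex T w).dist q := by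
    intro q hq hne
    rw [Point.dist_vertex_vertex]
    by_cases hv : ∃ v, q = Point.vertex T v
    · obtain ⟨v, rfl⟩ := hv
      rw [Point.dist_vertex_vertex]
      rw [h.vertex_mem_minSet hT] at hq
      have h1 := hp.2 v hq
      have h2 := hT.connected.pos_dist_of_ne (u := p) (v := v) (by rintro rfl; exact hne rfl)
      exact_mod_cast (by omega)
    · push Not at hv
      obtain ⟨a, b, ha, hb, -, hd⟩ := Point.exists_dist_vertex_edge hT w hv
      rw [h.mem_minSet hT] at hq
      have h1 := hp.2 a (hq a ha)
      have h2 : (T.dist w p : ℝ) ≤ T.dist w a := by exact_mod_cast (by omega)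
      linarith
  have hmem := (h.vertex_mem_minSet hT p).2 hp.1
  constructor
  · rintro ⟨h1, h2⟩
    by_contra hne
    exact absurd (h2 _ hmem) (not_le.2 (key q h1 hne))
  · rintro rfl
    refine ⟨hmem, fun q hq => ?_⟩
    by_cases hne : q = Point.vertex T p
    · rw [hne]
    · exact (key q hq hne).le

variable {hT : T.IsTree} {o : V} {ω : PathOrder T o}

theorem outerVertex_vertex (v : V) : outerVertex o (Point.vertex T v) = v := by
  have := ((Point.vertex T v).coord.support.exists_max_image (T.dist o)
    (Point.vertex T v).support_nonempty).choose_spec.1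
  exact Finset.mem_singleton.1 (Finset.ext_iff.1 (Point.support_vertex v) _ |>.1 this)

theorem segmentLT_vertex_iff (p q : V) :
    segmentLT hT ω (Point.vertex T p) (Point.vertex T q) ↔ vertexLT hT ω p q := by
  unfold segmentLT
  rw [Point.dist_vertex_vertex, Point.dist_vertex_vertex, outerVertex_vertex,
    outerVertex_vertex, Nat.cast_lt, Nat.cast_inj]
  change _ ∨ _ ∧ vertexLT hT ω p q ↔ _
  rw [vertexLT_iff]
  tauto

theorem IsTranslation.mem_centralInterval_iff (h : IsTranslation g l) {c p : V}
    (hc : IsAxisProj g l o c) (hp : p ∈ axisVertices g l) :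
    Point.vertex T p ∈ centralInterval hT ω g ↔
      2 * T.dist c p < l ∨ 2 * T.dist c p = l ∧
        ∀ q ∈ axisVertices g l, T.dist c q = T.dist c p → q ≠ p → vertexLT hT ω p q := by
  have e1 : (T.dist c p : ℝ) < l / 2 ↔ 2 * T.dist c p < l := by
    rw [lt_div_iff₀ two_pos, mul_comm]
    exact_mod_cast Iff.rfl
  have e2 : (T.dist c p : ℝ) = l / 2 ↔ 2 * T.dist c p = l := by
    rw [eq_div_iff two_ne_zero, mul_comm]
    exact_mod_cast Iff.rfl
  unfold centralInterval
  simp only [Set.mem_ofPred_eq, h.vertex_mem_minSet hT, h.isProj_iff hT hc, hp, true_and,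
    exists_eq_left, h.translationLength_eq hT, Point.dist_vertex_vertex, e1, e2]
  refine or_congr_right (and_congr_right fun heq => ?_)
  have heq' := e2.2 heq
  constructor
  · intro H q hq hd hne
    rw [← segmentLT_vertex_iff]
    refine H _ ((h.vertex_mem_minSet hT q).2 hq) ?_ (fun he => hne (Point.vertex_injective he))
    rw [Point.dist_vertex_vertex, hd, heq']
  · intro H q hq hd hne
    by_cases hv : ∃ v, q = Point.vertex T v
    · obtain ⟨v, rfl⟩ := hv
      rw [segmentLT_vertex_iff]
      rw [Point.dist_vertex_vertex, ← heq', Nat.cast_inj] at hd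
      exact H v ((h.vertex_mem_minSet hT v).1 hq) hd (fun he => hne (by rw [he]))
    -- A non-vertex point has non-integral distance from `c`, whereas `l / 2` is here the integer
    -- `d(c, p)`; end points at midpoints of edges never compete with a vertex.
    · exfalso
      push Not at hv
      obtain ⟨a, b, -, hb0, hb1, hd'⟩ := Point.exists_dist_vertex_edge hT c hv
      rw [hd, ← heq'] at hd'
      have h1 : T.dist c a < T.dist c p := by
        have : (T.dist c a : ℝ) < T.dist c p := by linarith
        exact_mod_cast this
      have h2 : T.dist c p < T.dist c a + 1 := by
        have : (T.dist c p : ℝ) < T.dist c a + 1 := by linarith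
        exact_mod_cast this
      omega

theorem IsStronglyNReduced.verts_fundamentalSubtree {X : Set (T ≃g T)}
    (hX : IsStronglyNReduced hT ω X) :
    (fundamentalSubtree hT ω X).verts = localMinima hT ω X := by
  have key : ∀ g ∈ X, ∀ w, (∃ p, IsProj (minSet g) (Point.vertex T w) p ∧
      p ∈ centralInterval hT ω g) ↔ vertexLT hT ω w (g w) ∧ vertexLT hT ω w (g⁻¹ w) := by
    intro g hg w
    have h := IsTranslation.of_lt hT (hX.hyperbolic (Or.inl hg))
    obtain ⟨c, hc⟩ := h.exists_isAxisProj hT o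
    obtain ⟨p, hp⟩ := h.exists_isAxisProj hT w
    simp only [h.isProj_iff hT hp, exists_eq_left]
    rw [h.vertexLT_and_vertexLT_iff hc hp, h.mem_centralInterval_iff hc hp.1]
  ext w
  change (∀ g ∈ X, _) ↔ _
  constructor
  · rintro H x (hx | hx)
    · exact ((key x hx w).1 (H x hx)).1
    · have := ((key _ hx w).1 (H _ hx)).2
      rwa [inv_inv] at this
  · intro H g hg
    exact (key g hg w).2 ⟨H g (Or.inl hg), H g⁻¹ (Or.inr (by rwa [inv_inv]))⟩

end Realisation

end TreeAut

theorem mainTheorem6 {V : Type*} {T : SimpleGraph V} (hT : T.IsTree) (o : V)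
    (ω : TreeAut.PathOrder T o) (X : Set (T ≃g T)) (hfin : X.Finite)
    (hX : TreeAut.IsStronglyNReduced hT ω X) :
    (TreeAut.fundamentalSubtree hT ω X).verts =
        {w : V | ∀ g ∈ Subgroup.closure X, g ≠ 1 →
          ω.lt (TreeAut.geodesic hT o w) (TreeAut.geodesic hT o (g w))} ∧
      TreeAut.IsFundamentalDomain (Subgroup.closure X) (TreeAut.fundamentalSubtree hT ω X) := by
  refine ⟨hX.verts_fundamentalSubtree.trans hX.localMinima_eq, hX.isFundamentalDomain ?_⟩
  rw [← hX.verts_fundamentalSubtree]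
  rfl
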